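/- Let $p$ be a prime number, $k$ a perfect field of characteristic $p$, and $W_2$ the functor of $p$-typical Witt vectors of length two. Let $S$ be a reduced $k$-scheme with absolute Frobenius $\mathrm{Frob}$, and let $\mathrm{Frob}_*B^1_S$ denote the cokernel of the $\mathcal O_S$-linear map $\mathcal O_S\to\mathrm{Frob}_*\mathcal O_S$, $x\mapsto x^p$. A lift of $S$ to $W_2(k)$ is a flat $W_2(k)$-scheme $S_2$ together with a morphism $i:S\to S_2$ that identifies $S$, as a $k$-scheme, with $S_2\times_{\mathrm{Spec}\,W_2(k)}\mathrm{Spec}\,k$. Multiplication by $p$ on $\mathcal O_{S_2}$ identifies $\mathcal O_S$ with the kernel of $\mathcal O_{S_2}\to\mathcal O_S$, so that a lift gives a square-zero extension $0\to\mathcal O_S\to\mathcal O_{S_2}\to\mathcal O_S\to0$. (1) If $S$ is Frobenius-split, i.e. if the sequence of $\mathcal O_S$-modules $$0\to\mathcal O_S\to\mathrm{Frob}_*\mathcal O_S\to\mathrm{Frob}_*B^1_S\to0\qquad(*)$$ splits, then $S$ admits a lift to $W_2(k)$. (2) More precisely, every splitting of $(*)$ canonically determines such a lift, in the following sense. Let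 $\sigma$ be a splitting of $(*)$ and let $r:\mathrm{Frob}_*\mathcal O_S\to\mathcal O_S$ be the corresponding retraction. Then there are a lift $S_2$ of $S$ and a morphism $\theta:W_2(\mathcal O_S)\to\mathcal O_{S_2}$ of sheaves of $W_2(k)$-algebras which presents $0\to\mathcal O_S\to\mathcal O_{S_2}\to\mathcal O_S\to0$ as the pushforward along $r$ of the extension $0\to\mathrm{Frob}_*\mathcal O_S\to W_2(\mathcal O_S)\to\mathcal O_S\to0$, i.e. which induces the identity on the quotients $\mathcal O_S$ and $r$ on the kernels. Any two such pairs $(S_2,\theta)$ for the same $(S,\sigma)$ are isomorphic by a unique isomorphism of $W_2(k)$-schemes that is compatible with the morphisms $i$ and $\theta$. (3) The pair $(S_2,\theta)$ is functorial in $(S,\sigma)$: let $S,S'$ be reduced $k$-schemes with splittings $\sigma,\sigma'$, with retractions $r,r'$, and with pairs $(S_2,\theta)$, $(S_2',\theta')$ as in (2). If $g:S\to S'$ is a morphism of $k$-schemes for which $g^\sharp:\mathcal O_{S'}\to g_*\mathcal O_S$ satisfies $g^\sharp\circ r'=r\circ g^\sharp$, then there is a unique morphism of $W_2(k)$-schemes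 $g_2:S_2\to S_2'$ that lifts $g$ and is compatible with $\theta$ and $\theta'$, i.e. $g_2^\sharp\circ\theta'=\theta\circ W_2(g^\sharp)$. -/

import Mathlib

open CategoryTheory AlgebraicGeometry

universe u

namespace FrobLift

section Witt

variable (p : ℕ) [hp : Fact p.Prime]

/-- The ring `W₂(R)` of `p`-typical Witt vectors of length two. -/
abbrev W2 (R : Type u) : Type u := TruncatedWittVector p 2 R

/-- The truncation `W₂(R) → R`, `(x₀, x₁) ↦ x₀`. -/
noncomputable def W2.toBase (R : Type u) [CommRing R] : W2 p R →+* R where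
  toFun x := x.coeff 0
  map_one' := by
    rw [← map_one (WittVector.truncate (p := p) (R := R) 2), WittVector.coeff_truncate]
    exact map_one (WittVector.constantCoeff (p := p) (R := R))
  map_zero' := TruncatedWittVector.coeff_zero p 2 R 0
  map_mul' x y := by
    obtain ⟨x, rfl⟩ := WittVector.truncate_surjective p 2 R x
    obtain ⟨y, rfl⟩ := WittVector.truncate_surjective p 2 R y
    rw [← map_mul]
    simp only [WittVector.coeff_truncate]
    exact map_mul (WittVector.constantCoeff (p := p) (R := R)) x y
  map_add' x y := by
    obtain ⟨x, rfl⟩ := WittVector.truncate_surjective p 2 R x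
    obtain ⟨y, rfl⟩ := WittVector.truncate_surjective p 2 R y
    rw [← map_add]
    simp only [WittVector.coeff_truncate]
    exact map_add (WittVector.constantCoeff (p := p) (R := R)) x y

/-- The Verschiebung `R → W₂(R)`, `y ↦ (0, y)`, whose image is the kernel of `W₂(R) → R`. -/
def W2.ver {R : Type u} [CommRing R] (y : R) : W2 p R := TruncatedWittVector.mk p ![0, y]

lemma W2.map_truncate {R S : Type u} [CommRing R] [CommRing S] (f : R →+* S)
    (x : WittVector p R) :
    (TruncatedWittVector.mk p (fun i => f ((WittVector.truncate 2 x).coeff i)) : W2 p S) =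
      WittVector.truncate 2 (WittVector.map f x) := by
  ext i
  simp [TruncatedWittVector.coeff_mk, WittVector.coeff_truncate, WittVector.map_coeff]

/-- Functoriality of `W₂`: `(x₀, x₁) ↦ (f x₀, f x₁)`. -/
noncomputable def W2.map {R S : Type u} [CommRing R] [CommRing S] (f : R →+* S) :
    W2 p R →+* W2 p S where
  toFun x := TruncatedWittVector.mk p (fun i => f (x.coeff i))
  map_one' := by
    rw [← map_one (WittVector.truncate (p := p) (R := R) 2), W2.map_truncate]
    simp
  map_zero' := by
    rw [← map_zero (WittVector.truncate (p := p) (R := R) 2), W2.map_truncate]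
    simp
  map_mul' x y := by
    obtain ⟨x, rfl⟩ := WittVector.truncate_surjective p 2 R x
    obtain ⟨y, rfl⟩ := WittVector.truncate_surjective p 2 R y
    rw [← map_mul, W2.map_truncate, W2.map_truncate, W2.map_truncate, map_mul, map_mul]
  map_add' x y := by
    obtain ⟨x, rfl⟩ := WittVector.truncate_surjective p 2 R x
    obtain ⟨y, rfl⟩ := WittVector.truncate_surjective p 2 R y
    rw [← map_add, W2.map_truncate, W2.map_truncate, W2.map_truncate, map_add, map_add]

end Witt

/-- For a scheme `X` over `Spec R`, the structure homomorphism from `R` to the sections of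
the structure sheaf over an open subset. -/
noncomputable def structureHom {R : Type u} [CommRing R] {X : Scheme.{u}}
    (f : X ⟶ Spec (.of R)) (U : X.Opens) : R →+* Γ(X, U) :=
  (f.appLE ⊤ U le_top).hom.comp (Scheme.ΓSpecIso (.of R)).inv.hom

/-- The `p`-th power map as a ring homomorphism, on any ring in which `p = 0` (the zero ring
included). -/
def powHom (p : ℕ) [hp : Fact p.Prime] {R : Type u} [CommRing R] (h : (p : R) = 0) : R →+* R where
  toFun x := x ^ p
  map_one' := one_pow p
  map_zero' := zero_pow hp.out.ne_zero
  map_mul' x y := mul_pow x y p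
  map_add' x y := by
    obtain ⟨r, hr⟩ := exists_add_pow_prime_eq hp.out x y
    rw [hr, h]
    ring

lemma natCast_eq_zero (p : ℕ) {k : Type u} [Field k] [CharP k p]
    {S : Scheme.{u}} (f : S ⟶ Spec (.of k)) (U : S.Opens) : (p : Γ(S, U)) = 0 := by
  rw [← map_natCast (structureHom f U) p, CharP.cast_eq_zero, map_zero]

/-- The absolute Frobenius of a scheme over a field of characteristic `p`: the identity on the
underlying space, and `x ↦ x ^ p` on sections of the structure sheaf. -/
noncomputable def absFrob (p : ℕ) [hp : Fact p.Prime] {k : Type u} [Field k] [CharP k p]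
    {S : Scheme.{u}} (f : S ⟶ Spec (.of k)) : S ⟶ S where
  base := 𝟙 _
  c :=
    { app := fun U => CommRingCat.ofHom (powHom p (natCast_eq_zero p f U.unop))
      naturality := by
        intro U V i
        ext x
        exact (map_pow (S.presheaf.map i).hom x p).symm }
  prop x := by
    constructor
    intro a ha
    obtain ⟨U, hxU, s, rfl⟩ := S.presheaf.exists_germ_eq a
    erw [PresheafedSpace.stalkMap_germ_apply] at ha
    have h : S.presheaf.germ U x hxU (s ^ p) = (S.presheaf.germ U x hxU s) ^ p :=
      map_pow (S.presheaf.germ U x hxU).hom s p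
    change IsUnit (S.presheaf.germ U x hxU (s ^ p)) at ha
    rw [h] at ha
    exact (isUnit_pow_iff hp.out.ne_zero).mp ha

/-- The structure sheaf `𝒪_X` as a module over itself. -/
noncomputable abbrev unitModule (X : Scheme.{u}) : X.Modules :=
  SheafOfModules.unit X.ringCatSheaf

/-- The morphism `𝒪_Y → g_* 𝒪_X` of `𝒪_Y`-modules attached to a morphism `g : X ⟶ Y`, given on
sections by the homomorphism of rings `g^♯`. -/
noncomputable def unitMap {X Y : Scheme.{u}} (g : X ⟶ Y) :
    unitModule Y ⟶ (Scheme.Modules.pushforward g).obj (unitModule X) :=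
  SheafOfModules.unitToPushforwardObjUnit g.toRingCatSheafHom

section Lifts

variable (p : ℕ) [hp : Fact p.Prime] {k : Type u} [Field k] [CharP k p]
    {S : Scheme.{u}} (f : S ⟶ Spec (.of k))

/-- The sequence of `𝒪_S`-modules `𝒪_S → Frob_* 𝒪_S → Frob_* B¹_S`, where the first arrow is
`x ↦ x ^ p` and the second arrow is its cokernel. -/
noncomputable def frobSequence : ShortComplex S.Modules :=
  ShortComplex.mk (unitMap (absFrob p f)) (Limits.cokernel.π _) (Limits.cokernel.condition _)

/-- A lift of `S` to a flat `W₂(k)`-scheme: a flat morphism `X ⟶ Spec W₂(k)`, together with an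
identification of `S` with its base change to `Spec k`. -/
structure FlatLift where
  /-- the lift -/
  X : Scheme.{u}
  /-- its structure morphism -/
  str : X ⟶ Spec (.of (W2 p k))
  flat : Flat str
  /-- the closed immersion of the special fibre -/
  i : S ⟶ X
  isPullback : IsPullback i f str (Spec.map (CommRingCat.ofHom (W2.toBase p k)))

variable {p f}

/-- The retraction `Frob_* 𝒪_S → 𝒪_S` that belongs to a splitting of the Frobenius sequence,
on sections over `U`. (Sections of `Frob_* 𝒪_S` over `U` are sections of `𝒪_S` over `U`.) -/
noncomputable def retraction (σ : (frobSequence p f).Splitting) (U : S.Opens) :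
    Γ(S, U) →+ Γ(S, U) :=
  (Scheme.Modules.Hom.app σ.r U).hom

/-- A lift of `S` whose structure sheaf is the pushforward, along the retraction
`r : Frob_* 𝒪_S → 𝒪_S` that belongs to the splitting `σ`, of the square-zero extension
`0 → Frob_* 𝒪_S → W₂(𝒪_S) → 𝒪_S → 0`. In other words, a flat lift `X`, together with a
morphism from this extension to the extension `0 → 𝒪_S → 𝒪_X → 𝒪_S → 0`, that is the identity on
the quotients and `r` on the kernels. Here `𝒪_S` is identified with the kernel `p 𝒪_X` of
`𝒪_X → 𝒪_S` via the multiplication by `p` on `𝒪_X`. -/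
structure SplitLift (σ : (frobSequence p f).Splitting) extends FlatLift p f where
  /-- the homomorphism of sheaves of rings `W₂(𝒪_S) → 𝒪_X` -/
  θ (U : X.Opens) : W2 p Γ(S, i ⁻¹ᵁ U) →+* Γ(X, U)
  θ_restrict (U V : X.Opens) (h : V ≤ U) (w : W2 p Γ(S, i ⁻¹ᵁ U)) :
    (X.presheaf.map (homOfLE h).op).hom (θ U w) =
      θ V (W2.map p (S.presheaf.map (homOfLE (i.preimage_mono h)).op).hom w)
  θ_linear (U : X.Opens) (c : W2 p k) :
    θ U (W2.map p (structureHom f (i ⁻¹ᵁ U)) c) = structureHom str U c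
  θ_toBase (U : X.Opens) (w : W2 p Γ(S, i ⁻¹ᵁ U)) :
    (i.app U).hom (θ U w) = W2.toBase p _ w
  θ_ver (U : X.Opens) (y : Γ(S, i ⁻¹ᵁ U)) (t : Γ(X, U)) :
    (i.app U).hom t = retraction σ (i ⁻¹ᵁ U) y → θ U (W2.ver p y) = p * t

variable {S' : Scheme.{u}} {f' : S' ⟶ Spec (.of k)}

/-- A morphism of schemes is compatible with given Frobenius splittings if the induced morphism
of structure sheaves commutes with the retractions. -/
def RespectsSplittings (σ : (frobSequence p f).Splitting) (σ' : (frobSequence p f').Splitting)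
    (g : S ⟶ S') : Prop :=
  ∀ (U : S'.Opens) (y : Γ(S', U)),
    (g.app U).hom (retraction σ' U y) = retraction σ (g ⁻¹ᵁ U) ((g.app U).hom y)

/-- `g₂ : X ⟶ X'` is a morphism of `W₂(k)`-schemes that lifts `g : S ⟶ S'` and is compatible with
the homomorphisms `W₂(𝒪_S) → 𝒪_X` and `W₂(𝒪_S') → 𝒪_X'`. -/
structure IsLiftOf {σ : (frobSequence p f).Splitting} {σ' : (frobSequence p f').Splitting}
    (L : SplitLift σ) (L' : SplitLift σ') (g : S ⟶ S') (g₂ : L.X ⟶ L'.X) : Prop where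
  comp_str : g₂ ≫ L'.str = L.str
  lift : L.i ≫ g₂ = g ≫ L'.i
  comm (U : L'.X.Opens) (w : W2 p Γ(S', L'.i ⁻¹ᵁ U)) :
    (g₂.app U).hom (L'.θ U w) =
      L.θ (g₂ ⁻¹ᵁ U) (W2.map p (g.appLE (L'.i ⁻¹ᵁ U) (L.i ⁻¹ᵁ (g₂ ⁻¹ᵁ U))
        (le_of_eq (by rw [← Scheme.Hom.comp_preimage, lift, Scheme.Hom.comp_preimage]))).hom w)

end Lifts

end FrobLift

/-!
Let `r : Frob_* 𝒪_S → 𝒪_S` be the retraction that belongs to a splitting. It is additive, satisfies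
`r (x ^ p * y) = x * r y`, and sends `1` to `1`.

**Existence.** For a ring `A` of characteristic `p` with such an `r`, the subset `V(ker r)` of
`W₂(A)` is an ideal, because `V(y) * x = V(y * x₀ ^ p)`. The pushforward of
`0 → A → W₂(A) → A → 0` along `r` is the quotient `W₂(A) / V(ker r)` (`FrobRetraction.Ext`). The map
`(x₀, x₁) ↦ (x₀, r x₁)` is a bijection from this quotient onto `A × A`, under which multiplication
by the Teichmüller representative `[a]` is multiplication by `a` on both coordinates. Two facts
follow. Applied to the rings `Γ(S, U)`, the construction gives a sheaf of rings on the space of `S`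
(`extPresheaf_isSheaf`), since as a sheaf of sets it is `𝒪_S × 𝒪_S`; and it commutes with the
localization at an element `a` of `A` (`FrobRetraction.isLocalization_map`), so that the sheaf is
the structure sheaf of a scheme (`extScheme`), affine over the affine open subsets of `S`. In the
quotient, `p` times the class of `x` is the class of `V(x₀ ^ p)`, which has coordinates `(0, x₀)`.
Hence the elements killed by `p`, the multiples of `p`, and the elements with first coordinate `0`
are the same. As `k` is perfect, every ideal of `W₂(k)` is `0`, `p W₂(k)` or `W₂(k)`; so flatness
over `W₂(k)` means that the elements killed by `p` are the multiples of `p`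
(`W2.flat_of_natCast_smul_eq_zero`). That the latter are the kernel of the map to `𝒪_S` makes `S`
the special fibre (`extι_isPullback`), and the result is the lift `extLift`.

**Uniqueness and functoriality.** Let `(X, θ)` be any lift with its homomorphism
`θ : W₂(𝒪_S) → 𝒪_X`. On affine open subsets of `X`, flatness and the cartesian square show that the
kernel of `𝒪_X → 𝒪_S`, the multiples of `p`, and the elements killed by `p` agree. From this,
`θ` has kernel `V(ker r)` (`SplitLift.θ_eq_zero_iff`), and it is surjective on sections over *every*
open subset (`SplitLift.θ_surjective`): a section of `𝒪_X` that vanishes on `S` is locally of the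
form `p x = θ (V(t ^ p))`, where `t`, the restriction of `x` to `S`, is unique and therefore glues.
So `𝒪_X` is determined by `r`, and for any `g : S ⟶ S'` that respects the retractions, `W₂(g^♯)`
induces a homomorphism of sheaves of rings `𝒪_{X'} → 𝒪_X`. It gives a morphism of schemes because
`S` and `X` have the same points, and a section of `𝒪_X` is invertible where its restriction to `S`
is. As `θ'` is surjective, nothing else is compatible with `θ` and `θ'`.
-/

namespace FrobLift

open TopologicalSpace Topology Opposite TensorProduct

/-! ### Witt vectors of length two -/

section

variable (p : ℕ) {A A' : Type u}

namespace W2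

@[ext] lemma ext {x y : W2 p A} (h₀ : x.coeff 0 = y.coeff 0) (h₁ : x.coeff 1 = y.coeff 1) : x = y :=
  TruncatedWittVector.ext fun i => by fin_cases i <;> assumption

variable [CommRing A] [CommRing A']

@[simp] lemma coeff_zero_ver (y : A) : (ver p y).coeff 0 = 0 := rfl

@[simp] lemma coeff_one_ver (y : A) : (ver p y).coeff 1 = y := rfl

lemma eq_ver {x : W2 p A} (h : x.coeff 0 = 0) : x = ver p (x.coeff 1) := by
  ext <;> simp [h]

variable [hp : Fact p.Prime]

@[simp] lemma toBase_apply (x : W2 p A) : toBase p A x = x.coeff 0 := rfl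

@[simp] lemma coeff_map (φ : A →+* A') (x : W2 p A) (i : Fin 2) :
    (map p φ x).coeff i = φ (x.coeff i) := rfl

lemma map_ver (φ : A →+* A') (y : A) : map p φ (ver p y) = ver p (φ y) := by
  ext <;> simp

lemma map_comp {A'' : Type u} [CommRing A''] (φ : A →+* A') (ψ : A' →+* A'') (x : W2 p A) :
    map p ψ (map p φ x) = map p (ψ.comp φ) x := rfl

lemma truncate_verschiebung (x : WittVector p A) :
    WittVector.truncate 2 (WittVector.verschiebung x) = ver p (x.coeff 0) := by
  ext <;> simp [WittVector.coeff_truncate]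

lemma ver_add (y z : A) : ver p (y + z) = ver p y + ver p z := by
  have h (a : A) : ver p a = WittVector.truncate 2
      (WittVector.verschiebung (WittVector.teichmuller p a)) := by
    rw [truncate_verschiebung, WittVector.teichmuller_coeff_zero]
  rw [h y, h z, ← map_add, ← map_add, truncate_verschiebung]
  congr 1
  exact (by simp : y + z = WittVector.constantCoeff (WittVector.teichmuller p y) +
    WittVector.constantCoeff (WittVector.teichmuller p z)).trans (map_add _ _ _).symm

/-- The Teichmüller representative `(a, 0)`. -/
noncomputable def teich : A →* W2 p A :=
  (WittVector.truncate (p := p) (R := A) 2).toMonoidHom.comp (WittVector.teichmuller p)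

@[simp] lemma coeff_zero_teich (a : A) : (teich p a).coeff 0 = a := by
  simp [teich, WittVector.coeff_truncate]

@[simp] lemma coeff_one_teich (a : A) : (teich p a).coeff 1 = 0 := by
  simp [teich, WittVector.coeff_truncate]

lemma map_teich (φ : A →+* A') (a : A) : map p φ (teich p a) = teich p (φ a) := by
  ext <;> simp

lemma eq_teich_add_ver (x : W2 p A) : x = teich p (x.coeff 0) + ver p (x.coeff 1) := by
  have h : teich p (x.coeff 0) + ver p (x.coeff 1) = WittVector.truncate 2
      (WittVector.teichmuller p (x.coeff 0) +
        WittVector.verschiebung (WittVector.teichmuller p (x.coeff 1))) := by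
    rw [map_add, truncate_verschiebung, WittVector.teichmuller_coeff_zero]
    rfl
  -- Witt vectors with disjoint supports are added componentwise.
  have hd (n : ℕ) : (WittVector.teichmuller p (x.coeff 0)).coeff n = 0 ∨
      (WittVector.verschiebung (WittVector.teichmuller p (x.coeff 1))).coeff n = 0 := by
    cases n with
    | zero => exact Or.inr (by simp)
    | succ n => exact Or.inl (WittVector.teichmuller_coeff_pos p _ _ n.succ_pos)
  rw [h]
  ext <;> rw [WittVector.coeff_truncate, WittVector.coeff_add_of_disjoint _ _ _ hd] <;> simp

lemma coeff_zero_add_ver (x : W2 p A) (y : A) : (x + ver p y).coeff 0 = x.coeff 0 := by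
  have := map_add (toBase p A) x (ver p y)
  simpa using this

lemma coeff_one_add_ver (x : W2 p A) (y : A) : (x + ver p y).coeff 1 = x.coeff 1 + y := by
  have h := eq_teich_add_ver p x
  have h' : x + ver p y = TruncatedWittVector.mk p ![x.coeff 0, x.coeff 1 + y] := by
    rw [eq_teich_add_ver p (TruncatedWittVector.mk p ![x.coeff 0, x.coeff 1 + y])]
    conv_lhs => rw [h]
    rw [add_assoc, ← ver_add]
    rfl
  rw [h']
  rfl

/-- Elements with the same image in `A` differ by an element of the image of the Verschiebung. -/
lemma eq_add_ver {x y : W2 p A} (h : x.coeff 0 = y.coeff 0) :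
    x = y + ver p (x.coeff 1 - y.coeff 1) := by
  ext
  · rw [coeff_zero_add_ver, h]
  · rw [coeff_one_add_ver, add_sub_cancel]

lemma ver_sub (y z : A) : ver p (y - z) = ver p y - ver p z := by
  rw [eq_sub_iff_add_eq, ← ver_add, sub_add_cancel]

@[simp] lemma ver_zero : ver p (0 : A) = 0 := by
  ext <;> simp

section CharP

variable (hA : (p : A) = 0)
include hA

lemma ver_mul (y : A) (x : W2 p A) : ver p y * x = ver p (y * x.coeff 0 ^ p) := by
  cases subsingleton_or_nontrivial A
  · ext <;> exact Subsingleton.elim _ _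
  have : CharP A p := (CharP.charP_iff_prime_eq_zero hp.out).2 hA
  obtain ⟨x, rfl⟩ := WittVector.truncate_surjective p 2 A x
  have h : ver p y = WittVector.truncate 2
      (WittVector.verschiebung (WittVector.teichmuller p y)) := by
    rw [truncate_verschiebung, WittVector.teichmuller_coeff_zero]
  rw [h, ← map_mul, ← WittVector.verschiebung_mul_frobenius, truncate_verschiebung]
  congr 1
  simp [WittVector.mul_coeff_zero, WittVector.coeff_frobenius_charP]

lemma coeff_one_teich_mul (a : A) (x : W2 p A) :
    (teich p a * x).coeff 1 = a ^ p * x.coeff 1 := by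
  conv_lhs => rw [eq_teich_add_ver p x]
  rw [mul_add, mul_comm _ (ver p _), ver_mul p hA, ← map_mul, coeff_one_add_ver,
    coeff_one_teich, coeff_zero_teich, zero_add, mul_comm]

lemma natCast_mul (x : W2 p A) : (p : W2 p A) * x = ver p (x.coeff 0 ^ p) := by
  cases subsingleton_or_nontrivial A
  · ext <;> exact Subsingleton.elim _ _
  have : CharP A p := (CharP.charP_iff_prime_eq_zero hp.out).2 hA
  obtain ⟨x, rfl⟩ := WittVector.truncate_surjective p 2 A x
  rw [← map_natCast (WittVector.truncate (p := p) (R := A) 2), ← map_mul, mul_comm,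
    ← WittVector.verschiebung_frobenius, truncate_verschiebung]
  simp [WittVector.coeff_frobenius_charP, WittVector.coeff_truncate]

end CharP
end W2

end

/-! ### Retractions of the Frobenius of a ring -/

section

variable (p : ℕ)

/-- A retraction of the Frobenius of a ring `A` in which `p = 0`: an additive map `r : A → A` with
`r (x ^ p * y) = x * r y` and `r 1 = 1`. -/
structure FrobRetraction (A : Type u) [CommRing A] extends A →+ A where
  natCast_eq_zero : (p : A) = 0
  pow_mul' (x y : A) : toFun (x ^ p * y) = x * toFun y
  one' : toFun 1 = 1

namespace FrobRetraction

variable {p} {A A' : Type u} [CommRing A] [CommRing A']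

instance : FunLike (FrobRetraction p A) A A where
  coe r := r.toFun
  coe_injective r s h := by
    cases r; cases s; congr; exact DFunLike.coe_injective h

instance : AddMonoidHomClass (FrobRetraction p A) A A where
  map_add r := r.toAddMonoidHom.map_add
  map_zero r := r.toAddMonoidHom.map_zero

variable (r : FrobRetraction p A) (r' : FrobRetraction p A')

lemma pow_mul (x y : A) : r (x ^ p * y) = x * r y := r.pow_mul' x y

@[simp] lemma pow (x : A) : r (x ^ p) = x := by
  have h : r 1 = 1 := r.one'
  rw [← mul_one (x ^ p), r.pow_mul, h, mul_one]

variable [hp : Fact p.Prime]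

/-- The ideal `V(ker r)` of `W₂(A)`. -/
def kerIdeal : Ideal (W2 p A) where
  carrier := {w | w.coeff 0 = 0 ∧ r (w.coeff 1) = 0}
  zero_mem' := ⟨TruncatedWittVector.coeff_zero p 2 A 0, by
    rw [TruncatedWittVector.coeff_zero, map_zero]⟩
  add_mem' := by
    rintro x y ⟨hx, hx'⟩ ⟨hy, hy'⟩
    rw [W2.eq_ver p hy]
    refine ⟨(W2.coeff_zero_add_ver p _ _).trans hx, ?_⟩
    rw [W2.coeff_one_add_ver, map_add, hx', hy', add_zero]
  smul_mem' := by
    rintro c x ⟨hx, hx'⟩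
    rw [W2.eq_ver p hx, smul_eq_mul, mul_comm, W2.ver_mul p r.natCast_eq_zero, mul_comm]
    exact ⟨W2.coeff_zero_ver p _, by rw [W2.coeff_one_ver, r.pow_mul, hx', mul_zero]⟩

/-- The pushforward of the extension `0 → A → W₂(A) → A → 0` along `r : A → A`, as a ring: the
quotient of `W₂(A)` by `V(ker r)`. -/
abbrev Ext : Type u := W2 p A ⧸ r.kerIdeal

/-- The quotient map `W₂(A) → r.Ext`. -/
noncomputable abbrev proj : W2 p A →+* r.Ext := Ideal.Quotient.mk r.kerIdeal

lemma proj_eq_proj_iff {x y : W2 p A} :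
    r.proj x = r.proj y ↔ x.coeff 0 = y.coeff 0 ∧ r (x.coeff 1) = r (y.coeff 1) := by
  rw [Ideal.Quotient.eq]
  have key (h : x.coeff 0 = y.coeff 0) : x - y = W2.ver p (x.coeff 1 - y.coeff 1) := by
    rw [sub_eq_iff_eq_add', ← W2.eq_add_ver p h]
  constructor
  · intro h
    have h0 : x.coeff 0 = y.coeff 0 := by
      have := map_sub (W2.toBase p A) x y
      rw [W2.toBase_apply, h.1] at this
      exact (sub_eq_zero.mp this.symm)
    refine ⟨h0, ?_⟩
    rw [key h0] at h
    have := h.2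
    rwa [W2.coeff_one_ver, map_sub, sub_eq_zero] at this
  · rintro ⟨h0, h1⟩
    rw [key h0]
    exact ⟨W2.coeff_zero_ver p _, by rw [W2.coeff_one_ver, map_sub, h1, sub_self]⟩

/-- The projection of the extension `r.Ext` of `A` onto `A`. -/
noncomputable def fst : r.Ext →+* A :=
  Ideal.Quotient.lift _ (W2.toBase p A) fun _ h => h.1

@[simp] lemma fst_proj (x : W2 p A) : r.fst (r.proj x) = x.coeff 0 := rfl

/-- The second coordinate `(x₀, x₁) ↦ r x₁` on `r.Ext`. It is not additive, but together with `fst`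
it identifies the set `r.Ext` with `A × A`. -/
noncomputable def snd (b : r.Ext) : A :=
  Quotient.liftOn' b (fun x => r (x.coeff 1)) fun _ _ h =>
    (r.proj_eq_proj_iff.mp (Quotient.sound' h)).2

@[simp] lemma snd_proj (x : W2 p A) : r.snd (r.proj x) = r (x.coeff 1) := rfl

variable {r} in
lemma ext {b c : r.Ext} (h₀ : r.fst b = r.fst c) (h₁ : r.snd b = r.snd c) : b = c := by
  obtain ⟨x, rfl⟩ := Ideal.Quotient.mk_surjective b
  obtain ⟨y, rfl⟩ := Ideal.Quotient.mk_surjective c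
  exact r.proj_eq_proj_iff.mpr ⟨h₀, h₁⟩

/-- The element of `r.Ext` with coordinates `a` and `t`. The second component is `t ^ p` because
`r (t ^ p) = t`. -/
noncomputable def pair (a t : A) : r.Ext := r.proj (W2.teich p a + W2.ver p (t ^ p))

@[simp] lemma fst_pair (a t : A) : r.fst (r.pair a t) = a := by
  rw [pair, fst_proj, W2.coeff_zero_add_ver, W2.coeff_zero_teich]

@[simp] lemma snd_pair (a t : A) : r.snd (r.pair a t) = t := by
  rw [pair, snd_proj, W2.coeff_one_add_ver, W2.coeff_one_teich, zero_add, pow]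

lemma fst_surjective : Function.Surjective r.fst := fun a => ⟨r.pair a 0, r.fst_pair a 0⟩

lemma natCast_mul_proj (x : W2 p A) :
    (p : r.Ext) * r.proj x = r.proj (W2.ver p (x.coeff 0 ^ p)) := by
  rw [← W2.natCast_mul p r.natCast_eq_zero, map_mul, map_natCast]

/-- An element of `r.Ext` is killed by `p` if and only if it lies in the kernel of `r.Ext → A`. -/
lemma natCast_mul_eq_zero_iff {b : r.Ext} : p * b = 0 ↔ r.fst b = 0 := by
  obtain ⟨x, rfl⟩ := Ideal.Quotient.mk_surjective b
  rw [natCast_mul_proj, ← map_zero r.proj, proj_eq_proj_iff]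
  simp [TruncatedWittVector.coeff_zero]

/-- An element of `r.Ext` is divisible by `p` if and only if it lies in the kernel of
`r.Ext → A`. -/
lemma natCast_dvd_iff {b : r.Ext} : (p : r.Ext) ∣ b ↔ r.fst b = 0 := by
  constructor
  · rintro ⟨c, rfl⟩
    rw [map_mul, map_natCast, r.natCast_eq_zero, zero_mul]
  · obtain ⟨x, rfl⟩ := Ideal.Quotient.mk_surjective b
    intro h
    refine ⟨r.proj (W2.teich p (r (x.coeff 1))), ?_⟩
    rw [natCast_mul_proj, proj_eq_proj_iff, W2.coeff_zero_ver, W2.coeff_one_ver,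
      W2.coeff_zero_teich, pow]
    exact ⟨h, rfl⟩

lemma proj_ver_eq {y : A} {b : r.Ext} (h : r.fst b = r y) : r.proj (W2.ver p y) = p * b := by
  obtain ⟨x, rfl⟩ := Ideal.Quotient.mk_surjective b
  rw [natCast_mul_proj, proj_eq_proj_iff, W2.coeff_zero_ver, W2.coeff_one_ver, W2.coeff_zero_ver,
    W2.coeff_one_ver, pow]
  exact ⟨rfl, h.symm⟩

lemma isNilpotent_of_fst_eq_zero {b : r.Ext} (h : r.fst b = 0) : IsNilpotent b := by
  obtain ⟨c, rfl⟩ := r.natCast_dvd_iff.mpr h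
  refine ⟨2, ?_⟩
  rw [sq, mul_assoc, r.natCast_mul_eq_zero_iff, map_mul, h, mul_zero]

lemma isUnit_iff {b : r.Ext} : IsUnit (r.fst b) ↔ IsUnit b := by
  refine ⟨fun h => ?_, fun h => h.map r.fst⟩
  obtain ⟨a, ha⟩ := h.exists_right_inv
  obtain ⟨c, rfl⟩ := r.fst_surjective a
  have : IsNilpotent (b * c - 1) := r.isNilpotent_of_fst_eq_zero (by simp [ha])
  have := this.isUnit_add_one
  rw [sub_add_cancel] at this
  exact isUnit_of_mul_isUnit_left this

@[simp] lemma fst_teich_mul (a : A) (b : r.Ext) :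
    r.fst (r.proj (W2.teich p a) * b) = a * r.fst b := by
  rw [map_mul, fst_proj, W2.coeff_zero_teich]

@[simp] lemma snd_teich_mul (a : A) (b : r.Ext) :
    r.snd (r.proj (W2.teich p a) * b) = a * r.snd b := by
  obtain ⟨x, rfl⟩ := Ideal.Quotient.mk_surjective b
  rw [← map_mul, snd_proj, W2.coeff_one_teich_mul p r.natCast_eq_zero, pow_mul, snd_proj]

section Map

variable {r r'} (φ : A →+* A') (h : ∀ y, φ (r y) = r' (φ y))

/-- Functoriality of `FrobRetraction.Ext` with respect to ring homomorphisms that commute with the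
retractions. -/
noncomputable def map : r.Ext →+* r'.Ext :=
  Ideal.quotientMap _ (W2.map p φ) fun x hx =>
    ⟨by simp [hx.1], by rw [W2.coeff_map, ← h, hx.2, map_zero]⟩

@[simp] lemma map_proj (x : W2 p A) : map φ h (r.proj x) = r'.proj (W2.map p φ x) := rfl

@[simp] lemma fst_map (b : r.Ext) : r'.fst (map φ h b) = φ (r.fst b) := by
  obtain ⟨x, rfl⟩ := Ideal.Quotient.mk_surjective b
  simp

@[simp] lemma snd_map (b : r.Ext) : r'.snd (map φ h b) = φ (r.snd b) := by
  obtain ⟨x, rfl⟩ := Ideal.Quotient.mk_surjective b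
  simp [h]

/-- In the coordinates `fst` and `snd`, multiplication by the class of `[a]` is multiplication by
`a`; hence `r.Ext` localizes like the `A`-module `A × A`. -/
lemma isLocalization_map (a : A)
    (hφ : letI := φ.toAlgebra; IsLocalization.Away a A') :
    letI := (map φ h).toAlgebra
    IsLocalization.Away (r.proj (W2.teich p a)) r'.Ext := by
  let _ := φ.toAlgebra
  let _ := (map φ h).toAlgebra
  have ha (n : ℕ) (b : r.Ext) :
      r.proj (W2.teich p a) ^ n * b = r.proj (W2.teich p (a ^ n)) * b := by
    rw [map_pow, map_pow]
  have hm (b : r.Ext) : algebraMap r.Ext r'.Ext b = map φ h b := rfl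
  have hx (x : A) : algebraMap A A' x = φ x := rfl
  refine IsLocalization.Away.mk _ ?_ ?_ ?_
  · rw [← r'.isUnit_iff, hm, fst_map, fst_proj, W2.coeff_zero_teich]
    exact IsLocalization.Away.algebraMap_isUnit a
  · intro s
    obtain ⟨n, x, hn⟩ := IsLocalization.Away.surj a (r'.fst s)
    obtain ⟨m, y, hm'⟩ := IsLocalization.Away.surj a (r'.snd s)
    refine ⟨n + m, r.pair (a ^ m * x) (a ^ n * y), ?_⟩
    rw [hx] at hn hm'
    rw [mul_comm, ← map_pow, ← mul_one (_ ^ (n + m)), ha, mul_one, hm, map_proj, W2.map_teich]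
    refine ext ?_ ?_
    · rw [fst_teich_mul, hm, fst_map, fst_pair, map_mul, map_pow, map_pow, ← hx x, ← hn]
      ring
    · rw [snd_teich_mul, hm, snd_map, snd_pair, map_mul, map_pow, map_pow, ← hx y, ← hm']
      ring
  · intro b c hbc
    rw [hm, hm] at hbc
    obtain ⟨n, hn⟩ := IsLocalization.Away.exists_of_eq (S := A') a
      (show algebraMap A A' (r.fst b) = algebraMap A A' (r.fst c) by
        rw [hx, hx, ← fst_map φ h, hbc, fst_map])
    obtain ⟨m, hm'⟩ := IsLocalization.Away.exists_of_eq (S := A') a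
      (show algebraMap A A' (r.snd b) = algebraMap A A' (r.snd c) by
        rw [hx, hx, ← snd_map φ h, hbc, snd_map])
    refine ⟨n + m, ?_⟩
    rw [ha, ha]
    refine ext ?_ ?_
    · rw [fst_teich_mul, fst_teich_mul, pow_add, mul_right_comm, hn, mul_right_comm]
    · rw [snd_teich_mul, snd_teich_mul, pow_add, mul_assoc, hm', mul_assoc]
end Map
end FrobRetraction

end

/-! ### Thickenings of locally ringed spaces -/

section

/-- A sheaf of rings on the space underlying a locally ringed space `S`, together with a morphism
to the structure sheaf that reflects units. -/
structure Thickening (S : LocallyRingedSpace.{u}) where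
  /-- the sheaf of rings, as a presheaf -/
  sheaf : S.toTopCat.Presheaf CommRingCat.{u}
  isSheaf : sheaf.IsSheaf
  /-- the morphism to the structure sheaf of `S` -/
  φ : sheaf ⟶ S.presheaf
  isUnit (U : (Opens S.toTopCat)ᵒᵖ) (b : sheaf.obj U) : IsUnit ((φ.app U).hom b) → IsUnit b

namespace Thickening

variable {S : LocallyRingedSpace.{u}} (T : Thickening S)

/-- The sheafed space underlying `Thickening.space`. -/
def sheafedSpace : SheafedSpace CommRingCat.{u} where
  carrier := S.toTopCat
  presheaf := T.sheaf
  IsSheaf := T.isSheaf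

/-- The morphism from `S` to its thickening, the identity on the underlying space. -/
def preι : S.toPresheafedSpace.Hom T.sheafedSpace.toPresheafedSpace where
  base := 𝟙 _
  c := { app := fun U => T.φ.app U, naturality := fun _ _ i => T.φ.naturality i }

lemma isLocalHom_stalkMap_preι (x : S) : IsLocalHom (T.preι.stalkMap x).hom := by
  constructor
  intro a ha
  obtain ⟨U, hxU, s, rfl⟩ := T.sheafedSpace.presheaf.exists_germ_eq a
  erw [PresheafedSpace.stalkMap_germ_apply] at ha
  obtain ⟨V, i, hxV, hV⟩ := RingedSpace.isUnit_res_of_isUnit_germ (X := S.toRingedSpace) U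
    (T.φ.app (op U) s) x hxU ha
  have h : IsUnit (T.sheaf.map i.op s) := by
    refine T.isUnit _ _ ?_
    erw [← ConcreteCategory.comp_apply, T.φ.naturality]
    exact hV
  have h2 := h.map (T.sheafedSpace.presheaf.germ V x hxV).hom
  erw [TopCat.Presheaf.germ_res_apply] at h2
  exact h2

/-- The locally ringed space with the space of `S` and the given sheaf of rings. -/
def space : LocallyRingedSpace.{u} where
  toSheafedSpace := T.sheafedSpace
  isLocalRing x := by
    have : IsLocalRing (S.presheaf.stalk x) := S.isLocalRing x
    exact @RingHom.domain_isLocalRing _ _ _ _ this _ (T.isLocalHom_stalkMap_preι x)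

/-- The morphism from `S` to its thickening, the identity on the underlying space. -/
def ι : S ⟶ T.space where
  toHom := T.preι
  prop := T.isLocalHom_stalkMap_preι

/-- The restriction of a thickening along an open embedding. -/
def restrict {U : TopCat.{u}} {f : U ⟶ S.toTopCat} (h : IsOpenEmbedding f) :
    Thickening (S.restrict h) where
  sheaf := h.functor.op ⋙ T.sheaf
  isSheaf := (T.sheafedSpace.restrict h).IsSheaf
  φ := Functor.whiskerLeft _ T.φ
  isUnit _ b := T.isUnit _ b

/-- Let `S` be isomorphic to the spectrum of its global sections. If, on global sections, the
thickening is a surjection with nil kernel, and if its sections on basic open sets are localizations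
of its global sections, then it is isomorphic to the spectrum of its global sections. -/
lemma isIso_toΓSpec [IsIso S.toΓSpec]
    (hsurj : Function.Surjective (T.φ.app (op ⊤)).hom)
    (hnil : ∀ b, (T.φ.app (op ⊤)).hom b = 0 → IsNilpotent b)
    {J : Type u} (g : J → T.sheaf.obj (op ⊤))
    (hg : Opens.IsBasis (Set.range fun j => PrimeSpectrum.basicOpen (g j)))
    (hloc : ∀ (j : J) (W : Opens S.toTopCat),
      W = S.toRingedSpace.basicOpen ((T.φ.app (op ⊤)).hom (g j)) →
        letI := (T.sheaf.map (homOfLE (le_top : W ≤ ⊤)).op).hom.toAlgebra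
        IsLocalization.Away (g j) (T.sheaf.obj (op W))) :
    IsIso T.space.toΓSpec := by
  have nat : T.ι ≫ T.space.toΓSpec = S.toΓSpec ≫ Spec.locallyRingedSpaceMap (T.φ.app (op ⊤)) :=
    identityToΓSpec.naturality T.ι
  have hb : T.space.toΓSpec.base = S.toΓSpec.base ≫ Spec.topMap (T.φ.app (op ⊤)) :=
    congrArg (fun q => q.base) nat
  have h1 : IsIso S.toΓSpec.base :=
    inferInstanceAs (IsIso (LocallyRingedSpace.forgetToTop.map S.toΓSpec))
  have h2 : IsIso (Spec.topMap (T.φ.app (op ⊤))) := by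
    rw [TopCat.isIso_iff_isHomeomorph]
    refine PrimeSpectrum.isHomeomorph_comap _ (fun x => ?_) (fun b hb => hnil b hb)
    obtain ⟨y, rfl⟩ := hsurj x
    exact ⟨1, one_pos, y, (pow_one _).symm⟩
  have h3 : IsIso T.space.toΓSpec.base := hb ▸ @IsIso.comp_isIso _ _ _ _ _ _ _ h1 h2
  have h4 : IsIso T.space.toΓSpec.c := by
    let α : Spec.structureSheaf (LocallyRingedSpace.Γ.obj (op T.space)) ⟶
      (TopCat.Sheaf.pushforward _ T.space.toΓSpec.base).obj T.space.𝒪 := ⟨T.space.toΓSpec.c⟩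
    have hα : IsIso α := by
      refine TopCat.Sheaf.isIso_iff_isIso_basis (B := fun j => PrimeSpectrum.basicOpen (g j)) hg
        fun j => ?_
      rw [ConcreteCategory.isIso_iff_bijective]
      let A := LocallyRingedSpace.Γ.obj (op T.space)
      let r : A := g j
      let _ : Algebra A (T.space.presheaf.obj (op (T.space.toΓSpecMapBasicOpen r))) :=
        (T.space.toToΓSpecMapBasicOpen r).hom.toAlgebra
      have hr : IsLocalization.Away r
          (T.space.presheaf.obj (op (T.space.toΓSpecMapBasicOpen r))) :=
        hloc j (T.space.toΓSpecMapBasicOpen r) <| (T.space.toΓSpecMapBasicOpen_eq r).trans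
          (LocallyRingedSpace.preimage_basicOpen T.ι (U := ⊤) r)
      let _ : Algebra A ((Spec.structureSheaf A).obj.obj (op (PrimeSpectrum.basicOpen r))) :=
        StructureSheaf.openAlgebra A _
      have hr' : IsLocalization.Away r
          ((Spec.structureSheaf A).obj.obj (op (PrimeSpectrum.basicOpen r))) :=
        StructureSheaf.IsLocalization.to_basicOpen A r
      exact IsLocalization.bijective (Submonoid.powers r)
        (S := (Spec.structureSheaf A).obj.obj (op (PrimeSpectrum.basicOpen r)))
        (Q := T.space.presheaf.obj (op (T.space.toΓSpecMapBasicOpen r)))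
        (α.hom.app (op (PrimeSpectrum.basicOpen r))).hom
        (congrArg CommRingCat.Hom.hom (T.space.toΓSpecSheafedSpace_app_spec r))
    exact @Functor.map_isIso _ _ _ _ _ _ (TopCat.Sheaf.forget _ _) α hα
  have h5 : IsIso T.space.toΓSpec.toHom := PresheafedSpace.isIso_of_components _
  have h6 : IsIso (LocallyRingedSpace.forgetToSheafedSpace.map T.space.toΓSpec) := by
    have : IsIso (SheafedSpace.forgetToPresheafedSpace.map
      (LocallyRingedSpace.forgetToSheafedSpace.map T.space.toΓSpec)) := h5
    exact isIso_of_reflects_iso _ SheafedSpace.forgetToPresheafedSpace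
  exact isIso_of_reflects_iso _ LocallyRingedSpace.forgetToSheafedSpace

end Thickening

end

/-! ### The pushforward of `W₂(𝒪_S)` as a sheaf of rings -/

section

variable {p : ℕ} [hp : Fact p.Prime] {k : Type u} [Field k] [CharP k p]
    {S : Scheme.{u}} {f : S ⟶ Spec (.of k)} (σ : (frobSequence p f).Splitting)

lemma retraction_naturality {U V : S.Opens} (i : op U ⟶ op V) (y : Γ(S, U)) :
    (S.presheaf.map i).hom (retraction σ U y) = retraction σ V ((S.presheaf.map i).hom y) :=
  (ConcreteCategory.congr_hom ((Scheme.Modules.Hom.mapPresheaf σ.r).naturality i) y).symm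

lemma retraction_pow (U : S.Opens) (x : Γ(S, U)) : retraction σ U (x ^ p) = x :=
  ConcreteCategory.congr_hom (congrArg (fun q => Scheme.Modules.Hom.app q U) σ.f_r) x

/-- The retraction of the Frobenius of `Γ(S, U)` that belongs to a splitting of the Frobenius
sequence. -/
noncomputable def sectionRetraction (U : S.Opens) : FrobRetraction p Γ(S, U) where
  toAddMonoidHom := retraction σ U
  natCast_eq_zero := natCast_eq_zero p f U
  pow_mul' x y := Scheme.Modules.Hom.app_smul σ.r x y
  one' := by simpa using retraction_pow σ U 1

/-- The restriction homomorphisms of `extPresheaf`. -/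
noncomputable def extRestrict {U V : S.Opens} (i : op U ⟶ op V) :
    (sectionRetraction σ U).Ext →+* (sectionRetraction σ V).Ext :=
  FrobRetraction.map (S.presheaf.map i).hom (retraction_naturality σ i)

lemma fst_extRestrict {U V : S.Opens} (i : op U ⟶ op V) (b : (sectionRetraction σ U).Ext) :
    (sectionRetraction σ V).fst (extRestrict σ i b) =
      (S.presheaf.map i).hom ((sectionRetraction σ U).fst b) :=
  FrobRetraction.fst_map _ _ b

lemma snd_extRestrict {U V : S.Opens} (i : op U ⟶ op V) (b : (sectionRetraction σ U).Ext) :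
    (sectionRetraction σ V).snd (extRestrict σ i b) =
      (S.presheaf.map i).hom ((sectionRetraction σ U).snd b) :=
  FrobRetraction.snd_map _ _ b

lemma extRestrict_id (U : S.Opens) : extRestrict σ (𝟙 (op U)) = RingHom.id _ :=
  RingHom.ext fun b => FrobRetraction.ext
    (by rw [fst_extRestrict, S.presheaf.map_id]; rfl)
    (by rw [snd_extRestrict, S.presheaf.map_id]; rfl)

lemma extRestrict_comp {U V W : S.Opens} (i : op U ⟶ op V) (j : op V ⟶ op W) :
    extRestrict σ (i ≫ j) = (extRestrict σ j).comp (extRestrict σ i) :=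
  RingHom.ext fun b => FrobRetraction.ext
    (by rw [RingHom.comp_apply, fst_extRestrict, fst_extRestrict, fst_extRestrict,
      S.presheaf.map_comp]; rfl)
    (by rw [RingHom.comp_apply, snd_extRestrict, snd_extRestrict, snd_extRestrict,
      S.presheaf.map_comp]; rfl)

/-- The pushforward of the extension `W₂(𝒪_S)` of `𝒪_S` along the retraction, as a presheaf of rings
on the space underlying `S`. -/
noncomputable def extPresheaf : TopCat.Presheaf CommRingCat.{u} S.carrier where
  obj U := .of (sectionRetraction σ U.unop).Ext
  map {U V} i := CommRingCat.ofHom (extRestrict σ (U := U.unop) (V := V.unop) i)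
  map_id U := congrArg CommRingCat.ofHom (extRestrict_id σ U.unop)
  map_comp i j := congrArg CommRingCat.ofHom (extRestrict_comp σ i j)

/-- In coordinates, `extPresheaf σ` is the sheaf of sets `𝒪_S × 𝒪_S`. -/
lemma extPresheaf_isSheaf : (extPresheaf σ).IsSheaf := by
  rw [TopCat.Presheaf.isSheaf_iff_isSheafUniqueGluing]
  intro ι U b hb
  have hfst : TopCat.Presheaf.IsCompatible S.presheaf U
      (fun j => (sectionRetraction σ (U j)).fst (b j)) := fun j l =>
    (fst_extRestrict σ _ _).symm.trans ((congrArg (sectionRetraction σ (U j ⊓ U l)).fst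
      (hb j l)).trans (fst_extRestrict σ _ _))
  have hsnd : TopCat.Presheaf.IsCompatible S.presheaf U
      (fun j => (sectionRetraction σ (U j)).snd (b j)) := fun j l =>
    (snd_extRestrict σ _ _).symm.trans ((congrArg (sectionRetraction σ (U j ⊓ U l)).snd
      (hb j l)).trans (snd_extRestrict σ _ _))
  obtain ⟨a, ha, ha'⟩ := S.sheaf.existsUnique_gluing U _ hfst
  obtain ⟨t, ht, ht'⟩ := S.sheaf.existsUnique_gluing U _ hsnd
  refine ⟨(sectionRetraction σ (iSup U)).pair a t, fun j => ?_, fun c hc => ?_⟩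
  · refine FrobRetraction.ext ((fst_extRestrict σ _ _).trans ?_)
      ((snd_extRestrict σ _ _).trans ?_)
    · exact (congrArg _ (FrobRetraction.fst_pair _ a t)).trans (ha j)
    · exact (congrArg _ (FrobRetraction.snd_pair _ a t)).trans (ht j)
  · refine FrobRetraction.ext (.trans (ha' _ fun j => ?_) (FrobRetraction.fst_pair _ a t).symm)
      (.trans (ht' _ fun j => ?_) (FrobRetraction.snd_pair _ a t).symm)
    · exact (fst_extRestrict σ _ _).symm.trans (congrArg (sectionRetraction σ (U j)).fst (hc j))
    · exact (snd_extRestrict σ _ _).symm.trans (congrArg (sectionRetraction σ (U j)).snd (hc j))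

/-- The thickening of `S` with structure sheaf `extPresheaf σ`. -/
noncomputable def extThickening : Thickening S.toLocallyRingedSpace where
  sheaf := extPresheaf σ
  isSheaf := extPresheaf_isSheaf σ
  φ := { app U := CommRingCat.ofHom (sectionRetraction σ U.unop).fst
         naturality _ _ i := CommRingCat.hom_ext <| RingHom.ext (fst_extRestrict σ i) }
  isUnit U _ := (sectionRetraction σ U.unop).isUnit_iff.mp

end

/-! ### The scheme with this structure sheaf -/

section

variable {p : ℕ} [hp : Fact p.Prime] {k : Type u} [Field k] [CharP k p]
    {S : Scheme.{u}} {f : S ⟶ Spec (.of k)} (σ : (frobSequence p f).Splitting)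

/-- The basic open sets of Teichmüller representatives form a basis of the spectrum of `r.Ext`. -/
lemma FrobRetraction.isBasis_basicOpen_teich {A : Type u} [CommRing A] (r : FrobRetraction p A) :
    Opens.IsBasis (Set.range fun a => PrimeSpectrum.basicOpen (r.proj (W2.teich p a))) := by
  convert! PrimeSpectrum.isBasis_basic_opens (R := r.Ext) using 1
  refine (Set.range_comp_subset_range _ PrimeSpectrum.basicOpen).antisymm ?_
  rintro _ ⟨b, rfl⟩
  refine ⟨r.fst b, ?_⟩
  -- `b` and `[b₀]` differ by a nilpotent element, so they have the same basic open set.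
  have h : IsNilpotent (r.proj (W2.teich p (r.fst b)) - b) :=
    r.isNilpotent_of_fst_eq_zero (by simp)
  ext x
  have hx : r.proj (W2.teich p (r.fst b)) - b ∈ x.asIdeal := by
    obtain ⟨n, hn⟩ := h
    exact x.2.mem_of_pow_mem n (hn ▸ zero_mem _)
  refine not_congr (?_ : r.proj (W2.teich p (r.fst b)) ∈ x.asIdeal ↔ b ∈ x.asIdeal)
  exact ⟨fun hy => by simpa using sub_mem hy hx, fun hy => by simpa using add_mem hx hy⟩

lemma isLocalization_extRestrict {U V : S.Opens} (i : op U ⟶ op V) (a : Γ(S, U))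
    (h : letI := (S.presheaf.map i).hom.toAlgebra; IsLocalization.Away a Γ(S, V)) :
    letI := (extRestrict σ i).toAlgebra
    IsLocalization.Away ((sectionRetraction σ U).proj (W2.teich p a)) (sectionRetraction σ V).Ext :=
  FrobRetraction.isLocalization_map _ _ a h

/-- The restriction of `extThickening σ` to an affine open subset of `S` is affine. -/
lemma isIso_toΓSpec_of_isAffineOpen {U : S.Opens} (hU : IsAffineOpen U) :
    IsIso ((extThickening σ).restrict U.isOpenEmbedding).space.toΓSpec := by
  have hU' : IsAffine U := hU
  have : IsIso (S.toLocallyRingedSpace.restrict U.isOpenEmbedding).toΓSpec :=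
    inferInstanceAs (IsIso (Scheme.forgetToLocallyRingedSpace.map U.toScheme.toSpecΓ))
  let V : S.Opens := U.isOpenEmbedding.functor.obj ⊤
  refine Thickening.isIso_toΓSpec _ (sectionRetraction σ V).fst_surjective
    (fun b hb => (sectionRetraction σ V).isNilpotent_of_fst_eq_zero hb)
    (fun a : Γ(S, V) => (sectionRetraction σ V).proj (W2.teich p a))
    (sectionRetraction σ V).isBasis_basicOpen_teich ?_
  intro a W hW
  refine isLocalization_extRestrict σ (V := U.isOpenEmbedding.functor.obj W) _ a ?_
  have hW' : W = U.toScheme.basicOpen (U := ⊤) a := hW.trans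
    (congrArg (fun c => U.toScheme.basicOpen (U := ⊤) c) (W2.coeff_zero_teich p a))
  subst hW'
  exact (isAffineOpen_top U.toScheme).isLocalization_basicOpen a

/-- The scheme with the underlying space of `S` and structure sheaf `extPresheaf σ`. -/
noncomputable def extScheme : Scheme.{u} where
  toLocallyRingedSpace := (extThickening σ).space
  local_affine x := by
    obtain ⟨_, ⟨U, hU, rfl⟩, hx, -⟩ :=
      S.isBasis_affineOpens.exists_subset_of_mem_open (Set.mem_univ (x : S)) isOpen_univ
    have := isIso_toΓSpec_of_isAffineOpen σ hU
    exact ⟨⟨U, hx⟩, _,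
      ⟨@asIso _ _ _ _ ((extThickening σ).restrict U.isOpenEmbedding).space.toΓSpec this⟩⟩

end

/-! ### Flatness over `W₂(k)` -/

section

section Flat
variable (p : ℕ) [hp : Fact p.Prime] {k : Type u} [Field k] [CharP k p]

lemma W2.isUnit_of_coeff_zero_ne_zero {a : W2 p k} (h : a.coeff 0 ≠ 0) : IsUnit a := by
  have hnil : IsNilpotent (a * W2.teich p (a.coeff 0)⁻¹ - 1) := by
    have h0 : (a * W2.teich p (a.coeff 0)⁻¹ - 1).coeff 0 = 0 := by
      rw [← W2.toBase_apply, map_sub, map_mul, map_one, W2.toBase_apply, W2.toBase_apply,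
        W2.coeff_zero_teich, mul_inv_cancel₀ h, sub_self]
    refine ⟨2, ?_⟩
    rw [sq, W2.eq_ver p h0, W2.ver_mul p (CharP.cast_eq_zero k p), W2.coeff_zero_ver,
      zero_pow hp.out.ne_zero, mul_zero, W2.ver_zero]
  have := hnil.isUnit_add_one
  rw [sub_add_cancel] at this
  exact isUnit_of_mul_isUnit_left this

lemma W2.natCast_mul_natCast : (p : W2 p k) * p = 0 := by
  rw [W2.natCast_mul p (CharP.cast_eq_zero k p)]
  have : (p : W2 p k).coeff 0 = 0 := by
    rw [← W2.toBase_apply, map_natCast, CharP.cast_eq_zero]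
  rw [this, zero_pow hp.out.ne_zero, W2.ver_zero]

variable [PerfectField k]

/-- As `k` is perfect, the kernel of `W₂(k) → k` consists of the elements `p [z] = (0, z ^ p)`. -/
lemma W2.exists_eq_natCast_mul_teich {a : W2 p k} (h : a.coeff 0 = 0) :
    ∃ z : k, a = p * W2.teich p z := by
  have := PerfectField.toPerfectRing (K := k) p
  obtain ⟨z, hz⟩ := surjective_frobenius k p (a.coeff 1)
  refine ⟨z, ?_⟩
  rw [W2.natCast_mul p (CharP.cast_eq_zero k p), W2.coeff_zero_teich, W2.eq_ver p h, ← hz]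
  rfl

lemma W2.isPrincipal (I : Ideal (W2 p k)) : ∃ a, I = Ideal.span {a} := by
  by_cases h : ∃ a ∈ I, a.coeff 0 ≠ 0
  · obtain ⟨a, ha, ha'⟩ := h
    refine ⟨1, ?_⟩
    rw [Ideal.span_singleton_one]
    exact Ideal.eq_top_of_isUnit_mem I ha (W2.isUnit_of_coeff_zero_ne_zero p ha')
  push Not at h
  by_cases h' : ∃ a ∈ I, a ≠ 0
  · obtain ⟨a, ha, ha'⟩ := h'
    refine ⟨a, le_antisymm (fun b hb => ?_) ((Ideal.span_singleton_le_iff_mem I).mpr ha)⟩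
    obtain ⟨z, rfl⟩ := W2.exists_eq_natCast_mul_teich p (h a ha)
    obtain ⟨w, rfl⟩ := W2.exists_eq_natCast_mul_teich p (h b hb)
    have hz : z ≠ 0 := by
      rintro rfl
      refine ha' ?_
      rw [W2.natCast_mul p (CharP.cast_eq_zero k p), W2.coeff_zero_teich,
        zero_pow hp.out.ne_zero, W2.ver_zero]
    rw [Ideal.mem_span_singleton]
    refine ⟨W2.teich p (z⁻¹ * w), ?_⟩
    rw [mul_assoc, ← map_mul, mul_inv_cancel_left₀ hz]
  · push Not at h'
    exact ⟨0, by rw [Ideal.span_singleton_eq_bot.mpr rfl]; exact (Submodule.eq_bot_iff I).mpr h'⟩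

/-- If `p x = 0` implies that `x` is divisible by `p`, then every element killed by `a ∈ W₂(k)` is
a multiple of an element of the annihilator of `a`. -/
lemma W2.exists_annihilator {M : Type u} [AddCommGroup M] [Module (W2 p k) M]
    (hM : ∀ x : M, (p : W2 p k) • x = 0 → ∃ y : M, x = (p : W2 p k) • y)
    (a : W2 p k) (x : M) (h : a • x = 0) : ∃ (c : W2 p k) (y : M), x = c • y ∧ c * a = 0 := by
  by_cases ha : a.coeff 0 = 0
  · obtain ⟨z, rfl⟩ := W2.exists_eq_natCast_mul_teich p ha
    by_cases hz : z = 0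
    · subst hz
      refine ⟨1, x, (one_smul _ _).symm, ?_⟩
      rw [one_mul, W2.natCast_mul p (CharP.cast_eq_zero k p), W2.coeff_zero_teich,
        zero_pow hp.out.ne_zero, W2.ver_zero]
    · rw [mul_smul] at h
      obtain ⟨y, hy⟩ := hM _ h
      refine ⟨p, W2.teich p z⁻¹ • y, ?_, by rw [← mul_assoc, W2.natCast_mul_natCast, zero_mul]⟩
      rw [smul_comm, ← hy, smul_smul, ← map_mul, inv_mul_cancel₀ hz, map_one, one_smul]
  · exact ⟨0, x, by rw [zero_smul, ← (W2.isUnit_of_coeff_zero_ne_zero p ha).smul_eq_zero, h],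
      zero_mul a⟩

/-- Flatness over `W₂(k)` amounts to exactness of multiplication by `p`. -/
lemma W2.flat_of_natCast_smul_eq_zero {M : Type u} [AddCommGroup M] [Module (W2 p k) M]
    (hM : ∀ x : M, (p : W2 p k) • x = 0 → ∃ y : M, x = (p : W2 p k) • y) :
    Module.Flat (W2 p k) M := by
  rw [Module.Flat.iff_lift_lsmul_comp_subtype_injective]
  intro I _
  obtain ⟨a, rfl⟩ := W2.isPrincipal p I
  rw [injective_iff_map_eq_zero]
  intro t ht
  let a' : Ideal.span {a} := ⟨a, Ideal.mem_span_singleton_self a⟩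
  have h : ∃ x : M, t = a' ⊗ₜ x := by
    clear ht
    induction t with
    | zero => exact ⟨0, (TensorProduct.tmul_zero _ _).symm⟩
    | add s t hs ht =>
      obtain ⟨x, rfl⟩ := hs
      obtain ⟨y, rfl⟩ := ht
      exact ⟨x + y, (TensorProduct.tmul_add _ _ _).symm⟩
    | tmul b x =>
      obtain ⟨b, hb⟩ := b
      obtain ⟨c, rfl⟩ := Ideal.mem_span_singleton'.mp hb
      refine ⟨c • x, ?_⟩
      rw [← TensorProduct.smul_tmul]
      rfl
  obtain ⟨x, rfl⟩ := h
  obtain ⟨c, y, rfl, hc⟩ := W2.exists_annihilator p hM a x (by simpa [a'] using ht)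
  rw [← TensorProduct.smul_tmul, show c • a' = 0 from Subtype.ext hc, TensorProduct.zero_tmul]

/-- In a flat `W₂(k)`-module, every element killed by `p` is a multiple of `p`: by the equational
criterion it is a combination with coefficients killed by `p`, and these are multiples of `p`. -/
lemma W2.exists_eq_natCast_smul {M : Type u} [AddCommGroup M] [Module (W2 p k) M]
    [Module.Flat (W2 p k) M] {x : M} (hx : (p : W2 p k) • x = 0) :
    ∃ y : M, x = (p : W2 p k) • y := by
  obtain ⟨n, a, y, hy, ha⟩ := Module.Flat.isTrivialRelation_of_sum_smul_eq_zero
    (R := W2 p k) (ι := Unit) (f := fun _ => (p : W2 p k)) (x := fun _ => x) (by simpa using hx)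
  have hdvd (j) : ∃ b, a () j = p * b := by
    have : p * a () j = 0 := by simpa using ha j
    rw [W2.natCast_mul p (CharP.cast_eq_zero k p)] at this
    have := congrArg (TruncatedWittVector.coeff 1) this
    rw [W2.coeff_one_ver, TruncatedWittVector.coeff_zero] at this
    obtain ⟨z, hz⟩ := W2.exists_eq_natCast_mul_teich p (pow_eq_zero_iff hp.out.ne_zero |>.mp this)
    exact ⟨_, hz⟩
  choose b hb using hdvd
  refine ⟨∑ j, b j • y j, ?_⟩
  rw [Finset.smul_sum]
  refine (hy ()).trans ?_
  exact Finset.sum_congr rfl fun j _ => by rw [hb, mul_smul]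

end Flat

end

/-! ### The lift attached to a splitting -/

section

section StructureHom

variable {R : Type u} [CommRing R] {X : Scheme.{u}}

lemma structureHom_top (f : X ⟶ Spec (.of R)) :
    structureHom f ⊤ = f.appTop.hom.comp (Scheme.ΓSpecIso (.of R)).inv.hom :=
  congrArg (fun q => (CommRingCat.Hom.hom q).comp (Scheme.ΓSpecIso (.of R)).inv.hom)
    f.app_eq_appLE.symm

lemma structureHom_comp_ΓSpecIso_hom (f : X ⟶ Spec (.of R)) (U : X.Opens) :
    (structureHom f U).comp (Scheme.ΓSpecIso (.of R)).hom.hom = (f.appLE ⊤ U le_top).hom :=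
  RingHom.ext fun c => congrArg (f.appLE ⊤ U le_top).hom
    (ConcreteCategory.congr_hom (Scheme.ΓSpecIso (.of R)).hom_inv_id c)

lemma flat_appLE_of_flat_structureHom {f : X ⟶ Spec (.of R)} {U : X.Opens}
    (h : (structureHom f U).Flat) : (f.appLE ⊤ U le_top).hom.Flat := by
  rw [← structureHom_comp_ΓSpecIso_hom]
  exact .comp (RingHom.Flat.of_bijective
    (ConcreteCategory.bijective_of_isIso (Scheme.ΓSpecIso (.of R)).hom)) h

lemma flat_structureHom (f : X ⟶ Spec (.of R)) [Flat f] {U : X.Opens} (hU : IsAffineOpen U) :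
    (structureHom f U).Flat :=
  .comp (RingHom.Flat.of_bijective
    (ConcreteCategory.bijective_of_isIso (Scheme.ΓSpecIso (.of R)).inv))
    (f.flat_appLE (isAffineOpen_top _) hU le_top)

lemma map_structureHom (f : X ⟶ Spec (.of R)) {U V : X.Opens} (i : op U ⟶ op V) (c : R) :
    (X.presheaf.map i).hom (structureHom f U c) = structureHom f V c := by
  have := f.appLE_map (U := ⊤) (V := U) le_top i
  exact ConcreteCategory.congr_hom this _

lemma W2.map_map_structureHom {p : ℕ} [Fact p.Prime] (f : X ⟶ Spec (.of R)) {U V : X.Opens}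
    (i : op U ⟶ op V) (c : W2 p R) :
    W2.map p (X.presheaf.map i).hom (W2.map p (structureHom f U) c) =
      W2.map p (structureHom f V) c := by
  ext <;> simp [map_structureHom]

lemma app_structureHom {Y : Scheme.{u}} (f : X ⟶ Spec (.of R)) (g : Y ⟶ X) (U : X.Opens) (c : R) :
    (g.app U).hom (structureHom f U c) = structureHom (g ≫ f) (g ⁻¹ᵁ U) c := by
  have := g.appLE_comp_appLE f ⊤ U (g ⁻¹ᵁ U) le_top le_rfl
  rw [← g.app_eq_appLE] at this
  exact ConcreteCategory.congr_hom this _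

lemma structureHom_comp_SpecMap {R' : Type u} [CommRing R'] (φ : R →+* R')
    (f : X ⟶ Spec (.of R')) (U : X.Opens) (c : R) :
    structureHom (f ≫ Spec.map (CommRingCat.ofHom φ)) U c = structureHom f U (φ c) := by
  have h := f.appLE_comp_appLE (Spec.map (CommRingCat.ofHom φ)) ⊤ ⊤ U le_top le_top
  have h' := Scheme.ΓSpecIso_inv_naturality (CommRingCat.ofHom φ)
  refine (ConcreteCategory.congr_hom h.symm _).trans ?_
  refine congrArg (f.appLE ⊤ U le_top).hom (.trans ?_ (ConcreteCategory.congr_hom h' c).symm)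
  exact ConcreteCategory.congr_hom (Spec.map (CommRingCat.ofHom φ)).app_eq_appLE.symm _

lemma structureHom_toSpecΓ (U : X.Opens) (a : Γ(X, ⊤)) :
    structureHom (R := Γ(X, ⊤)) X.toSpecΓ U a = (X.presheaf.map (homOfLE le_top).op).hom a := by
  have h1 : structureHom (R := Γ(X, ⊤)) X.toSpecΓ ⊤ a = a := by
    have h := X.toSpecΓ_appTop
    rw [structureHom_top]
    exact (ConcreteCategory.congr_hom h _).trans
      (ConcreteCategory.congr_hom (Scheme.ΓSpecIso Γ(X, ⊤)).inv_hom_id a)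
  rw [← map_structureHom (U := ⊤) X.toSpecΓ (homOfLE le_top).op, h1]

/-- Morphisms to an affine scheme are determined by the homomorphism on global sections. -/
lemma hom_ext_of_structureHom {f g : X ⟶ Spec (.of R)}
    (h : structureHom f ⊤ = structureHom g ⊤) : f = g := by
  refine ext_of_isAffine ?_
  rw [structureHom_top, structureHom_top] at h
  rw [← cancel_epi (Scheme.ΓSpecIso (.of R)).inv]
  exact CommRingCat.hom_ext h

end StructureHom

variable {p : ℕ} [hp : Fact p.Prime] {k : Type u} [Field k] [CharP k p]
    {S : Scheme.{u}} {f : S ⟶ Spec (.of k)} (σ : (frobSequence p f).Splitting)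

/-- The morphism `S ⟶ extScheme σ`, the identity on the underlying space. -/
noncomputable def extι : S ⟶ extScheme σ := ⟨(extThickening σ).ι⟩

/-- The homomorphism `W₂(𝒪_S) → 𝒪` to the structure sheaf of `extScheme σ`. -/
noncomputable def extθ (U : (extScheme σ).Opens) :
    W2 p Γ(S, extι σ ⁻¹ᵁ U) →+* Γ(extScheme σ, U) :=
  (sectionRetraction σ (extι σ ⁻¹ᵁ U)).proj

lemma isAffineOpen_extScheme {U : S.Opens} (hU : IsAffineOpen U) :
    IsAffineOpen (X := extScheme σ) U := by
  constructor
  have h : IsIso (Scheme.forgetToLocallyRingedSpace.map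
      (Scheme.Opens.toScheme (X := extScheme σ) U).toSpecΓ) :=
    isIso_toΓSpec_of_isAffineOpen σ hU
  exact isIso_of_reflects_iso _ Scheme.forgetToLocallyRingedSpace

instance : IsClosedImmersion (extι σ) where
  isClosedEmbedding := IsClosedEmbedding.id
  stalkMap_surjective x := fun a => by
    obtain ⟨U, hxU, s, rfl⟩ := S.presheaf.exists_germ_eq a
    refine ⟨(extScheme σ).presheaf.germ U x hxU ((sectionRetraction σ U).pair s 0), ?_⟩
    refine ((extι σ).germ_stalkMap_apply U x hxU _).trans ?_
    exact congrArg (S.presheaf.germ U x hxU) (FrobRetraction.fst_pair _ s 0)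

/-- The structure morphism of `extScheme σ` over `W₂(k)`. -/
noncomputable def extStr : extScheme σ ⟶ Spec (.of (W2 p k)) :=
  (extScheme σ).toSpecΓ ≫
    Spec.map (CommRingCat.ofHom ((extθ σ ⊤).comp (W2.map p (structureHom f ⊤))))

lemma extθ_restrict (U V : (extScheme σ).Opens) (h : V ≤ U) (w : W2 p Γ(S, extι σ ⁻¹ᵁ U)) :
    ((extScheme σ).presheaf.map (homOfLE h).op).hom (extθ σ U w) = extθ σ V
      (W2.map p (S.presheaf.map (homOfLE ((extι σ).preimage_mono h)).op).hom w) := rfl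

lemma extθ_linear (U : (extScheme σ).Opens) (c : W2 p k) :
    extθ σ U (W2.map p (structureHom f (extι σ ⁻¹ᵁ U)) c) = structureHom (extStr σ) U c := by
  refine .trans ?_ (structureHom_comp_SpecMap _ _ U c).symm
  refine .trans ?_ (structureHom_toSpecΓ U _).symm
  refine .trans ?_ (extθ_restrict σ ⊤ U le_top _).symm
  exact congrArg (extθ σ U) (W2.map_map_structureHom f _ c).symm

lemma extι_app_extθ (U : (extScheme σ).Opens) (w : W2 p Γ(S, extι σ ⁻¹ᵁ U)) :
    ((extι σ).app U).hom (extθ σ U w) = W2.toBase p _ w := rfl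

lemma natCast_dvd_of_extι_app_eq_zero {U : (extScheme σ).Opens} {a : Γ(extScheme σ, U)}
    (h : ((extι σ).app U).hom a = 0) : (p : Γ(extScheme σ, U)) ∣ a :=
  (sectionRetraction σ U).natCast_dvd_iff.mpr h

lemma extι_comp_extStr :
    extι σ ≫ extStr σ = f ≫ Spec.map (CommRingCat.ofHom (W2.toBase p k)) := by
  refine hom_ext_of_structureHom (RingHom.ext fun c => ?_)
  rw [structureHom_comp_SpecMap]
  refine (app_structureHom (extStr σ) (extι σ) ⊤ c).symm.trans ?_
  rw [← extθ_linear, extι_app_extθ]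
  rfl

/-- `S` is the special fibre: `extι σ` is a closed immersion whose ideal is generated by `p`, and a
morphism to `extScheme σ` from a scheme over `k` kills `p`. -/
lemma extι_isPullback :
    IsPullback (extι σ) f (extStr σ) (Spec.map (CommRingCat.ofHom (W2.toBase p k))) := by
  have hmono : IsClosedImmersion (Spec.map (CommRingCat.ofHom (W2.toBase p k))) :=
    IsClosedImmersion.spec_of_surjective _ fun a => ⟨W2.teich p a, W2.coeff_zero_teich p a⟩
  have hker (c : Limits.PullbackCone (extStr σ)
      (Spec.map (CommRingCat.ofHom (W2.toBase p k)))) : (extι σ).ker ≤ c.fst.ker := by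
    refine Scheme.IdealSheafData.le_ofIdeals_iff.mpr fun U a ha => ?_
    obtain ⟨b, rfl⟩ := natCast_dvd_of_extι_app_eq_zero σ
      (RingHom.mem_ker.mp ((extι σ).ideal_ker_le U ha))
    have h0 := natCast_eq_zero p c.snd (c.fst ⁻¹ᵁ U.1)
    rw [RingHom.mem_ker, map_mul, map_natCast, h0, zero_mul]
  refine ⟨⟨extι_comp_extStr σ⟩, ⟨Limits.PullbackCone.IsLimit.mk _
    (fun c => IsClosedImmersion.lift (extι σ) c.fst (hker c)) ?_ ?_ ?_⟩⟩
  · intro c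
    exact IsClosedImmersion.lift_fac _ _ _
  · intro c
    rw [← cancel_mono (Spec.map (CommRingCat.ofHom (W2.toBase p k))), Category.assoc,
      ← extι_comp_extStr σ, IsClosedImmersion.lift_fac_assoc, c.condition]
  · intro c m hm _
    rw [← cancel_mono (extι σ), hm, IsClosedImmersion.lift_fac]

variable [PerfectField k]

/-- A homomorphism from `W₂(k)` to `B` is flat if the elements of `B` killed by `p` are multiples of
`p`. The converse is `W2.dvd_of_flat`. -/
lemma W2.flat_ringHom {B : Type u} [CommRing B] (φ : W2 p k →+* B)
    (h : ∀ x : B, p * x = 0 → (p : B) ∣ x) : φ.Flat := by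
  let _ := φ.toAlgebra
  have hsmul (x : B) : (p : W2 p k) • x = p * x := by
    rw [Algebra.smul_def, map_natCast]
  refine W2.flat_of_natCast_smul_eq_zero p fun x hx => ?_
  obtain ⟨y, rfl⟩ := h x (by rw [← hsmul, hx])
  exact ⟨y, (hsmul y).symm⟩

lemma W2.dvd_of_flat {B : Type u} [CommRing B] {φ : W2 p k →+* B} (hφ : φ.Flat)
    {x : B} (h : p * x = 0) : (p : B) ∣ x := by
  let _ := φ.toAlgebra
  have : Module.Flat (W2 p k) B := hφ
  have hsmul (x : B) : (p : W2 p k) • x = p * x := by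
    rw [Algebra.smul_def, map_natCast]
  obtain ⟨y, rfl⟩ := W2.exists_eq_natCast_smul p (x := x) (by rw [hsmul, h])
  exact ⟨y, hsmul y⟩

instance : Flat (extStr σ) := by
  have hS : ⨆ U : S.affineOpens, (U : S.Opens) = ⊤ := iSup_affineOpens_eq_top S
  refine HasRingHomProperty.of_iSup_eq_top (P := @Flat) (X := extScheme σ)
    (fun U : S.affineOpens => ⟨U.1, isAffineOpen_extScheme σ U.2⟩) hS fun U => ?_
  exact flat_appLE_of_flat_structureHom <| W2.flat_ringHom _ fun x hx =>
    (sectionRetraction σ U.1).natCast_dvd_iff.mpr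
      ((sectionRetraction σ U.1).natCast_mul_eq_zero_iff.mp hx)

/-- The lift of `S` that belongs to a splitting of its Frobenius sequence. -/
noncomputable def extLift : SplitLift σ where
  X := extScheme σ
  str := extStr σ
  flat := inferInstance
  i := extι σ
  isPullback := extι_isPullback σ
  θ := extθ σ
  θ_restrict := extθ_restrict σ
  θ_linear := extθ_linear σ
  θ_toBase := extι_app_extθ σ
  θ_ver U _ _ h := (sectionRetraction σ (extι σ ⁻¹ᵁ U)).proj_ver_eq h

end

/-! ### The homomorphism `θ` of an arbitrary lift -/

section

variable {p : ℕ} [hp : Fact p.Prime] {k : Type u} [Field k] [CharP k p]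
    {S : Scheme.{u}} {f : S ⟶ Spec (.of k)}

lemma SplitLift.θ_ver_of_retraction_eq_zero {σ : (frobSequence p f).Splitting} (L : SplitLift σ)
    {U : L.X.Opens} {y : Γ(S, L.i ⁻¹ᵁ U)}
    (h : retraction σ _ y = 0) : L.θ U (W2.ver p y) = 0 := by
  rw [L.θ_ver U y 0 ((map_zero _).trans h.symm), mul_zero]

variable [PerfectField k]

lemma W2.toBase_surjective {A : Type u} [CommRing A] : Function.Surjective (W2.toBase p A) :=
  fun a => ⟨W2.teich p a, W2.coeff_zero_teich p a⟩

/-- A scheme over `W₂(k)` on which `p = 0` is a scheme over `k`. -/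
lemma W2.exists_comp_SpecMap_toBase {T : Scheme.{u}} (s : T ⟶ Spec (.of (W2 p k)))
    (hT : (p : Γ(T, ⊤)) = 0) :
    ∃ h : T ⟶ Spec (.of k), h ≫ Spec.map (CommRingCat.ofHom (W2.toBase p k)) = s := by
  have hker : RingHom.ker (W2.toBase p k) ≤ RingHom.ker (structureHom s ⊤) := by
    intro c hc
    obtain ⟨z, rfl⟩ := W2.exists_eq_natCast_mul_teich p (a := c) hc
    rw [RingHom.mem_ker, map_mul, map_natCast, hT, zero_mul]
  let ψ : k →+* Γ(T, ⊤) := RingHom.liftOfRightInverse (W2.toBase p k) (W2.teich p)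
    (W2.coeff_zero_teich p) ⟨structureHom s ⊤, hker⟩
  refine ⟨T.toSpecΓ ≫ Spec.map (CommRingCat.ofHom ψ), ?_⟩
  refine hom_ext_of_structureHom (RingHom.ext fun c => ?_)
  refine (structureHom_comp_SpecMap _ _ _ _).trans ?_
  refine (structureHom_comp_SpecMap ψ _ _ _).trans ?_
  refine (structureHom_toSpecΓ _ _).trans ?_
  refine (ConcreteCategory.congr_hom (T.presheaf.map_id _) (ψ (W2.toBase p k c))).trans ?_
  exact RingHom.liftOfRightInverse_comp_apply (W2.toBase p k) (W2.teich p)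
    (W2.coeff_zero_teich p) ⟨structureHom s ⊤, hker⟩ c

namespace FlatLift

variable (L : FlatLift p f)

instance : IsClosedImmersion L.i := by
  have : IsClosedImmersion (Spec.map (CommRingCat.ofHom (W2.toBase p k))) :=
    IsClosedImmersion.spec_of_surjective _ W2.toBase_surjective
  exact MorphismProperty.of_isPullback L.isPullback.flip this

instance : Surjective L.i := by
  have : Surjective (Spec.map (CommRingCat.ofHom (W2.toBase p k))) := by
    constructor
    refine (PrimeSpectrum.isHomeomorph_comap (W2.toBase p k) (fun a => ?_)
      (fun c hc => ?_)).surjective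
    · obtain ⟨c, rfl⟩ := W2.toBase_surjective (p := p) a
      exact ⟨1, one_pos, c, (pow_one _).symm⟩
    · obtain ⟨z, rfl⟩ := W2.exists_eq_natCast_mul_teich p hc
      refine ⟨2, ?_⟩
      rw [mul_pow, sq (p : W2 p k), W2.natCast_mul_natCast, zero_mul]
      exact Ideal.zero_mem _
  exact MorphismProperty.of_isPullback L.isPullback.flip this

instance : IsIso L.i.base := by
  rw [TopCat.isIso_iff_isHomeomorph]
  exact isHomeomorph_iff_isEmbedding_surjective.mpr
    ⟨L.i.isClosedEmbedding.isEmbedding, L.i.surjective⟩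

/-- On affine open subsets, the kernel of `𝒪_X → 𝒪_S` is generated by `p`. -/
lemma dvd_of_app_eq_zero {U : L.X.Opens} (hU : IsAffineOpen U) {a : Γ(L.X, U)}
    (h : (L.i.app U).hom a = 0) : (p : Γ(L.X, U)) ∣ a := by
  -- The closed subscheme `p = 0` of `U` lies over `Spec k`, so by the cartesian square its
  -- inclusion `q` factors through `S`; so a section that vanishes on `S` vanishes modulo `p`.
  let m := CommRingCat.ofHom (Ideal.Quotient.mk (Ideal.span {(p : Γ(L.X, U))}))
  let q := Spec.map m ≫ hU.fromSpec
  have hp0 : (p : Γ(L.X, U) ⧸ Ideal.span {(p : Γ(L.X, U))}) = 0 := by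
    rw [← map_natCast (Ideal.Quotient.mk _), Ideal.Quotient.eq_zero_iff_mem]
    exact Ideal.mem_span_singleton_self _
  obtain ⟨s, hs⟩ := W2.exists_comp_SpecMap_toBase (q ≫ L.str) (by
    rw [← map_natCast (Scheme.ΓSpecIso _).inv.hom p]
    exact (congrArg _ hp0).trans (map_zero _))
  let l := L.isPullback.lift q s hs.symm
  have hl : l ≫ L.i = q := L.isPullback.lift_fst _ _ _
  have h1 : hU.fromSpec.appLE U ⊤ (by simp) = (Scheme.ΓSpecIso _).inv := by
    rw [Scheme.Hom.appLE, hU.fromSpec_app_self, Category.assoc, ← Functor.map_comp]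
    exact (congrArg _ (CategoryTheory.Functor.map_id _ _)).trans (Category.comp_id _)
  have h2 := (Spec.map m).appLE_comp_appLE hU.fromSpec U ⊤ ⊤ (by simp) le_top
  have h3 : (⊤ : (Spec _).Opens) ≤ (l ≫ L.i) ⁻¹ᵁ U := by rw [hl]; simp [q]
  have h4 := l.appLE_comp_appLE L.i U (L.i ⁻¹ᵁ U) ⊤ le_rfl h3
  have h5 : ((l ≫ L.i).appLE U ⊤ h3).hom a = 0 := by
    rw [← Scheme.Hom.app_eq_appLE] at h4
    exact (ConcreteCategory.congr_hom h4 a).symm.trans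
      ((congrArg (l.appLE (L.i ⁻¹ᵁ U) ⊤ h3).hom h).trans (map_zero _))
  have h6 (e : ⊤ ≤ q ⁻¹ᵁ U) : (q.appLE U ⊤ e).hom a = 0 := by
    simpa only [hl] using h5
  have h7 : (Scheme.ΓSpecIso _).inv.hom (m.hom a) = 0 := by
    refine .trans ?_ (h6 (by simp [q]))
    refine .trans ?_ (ConcreteCategory.congr_hom h2 a)
    refine (ConcreteCategory.congr_hom (Scheme.ΓSpecIso_inv_naturality m) a).trans ?_
    rw [h1]
    exact ConcreteCategory.congr_hom (Spec.map m).app_eq_appLE _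
  have h8 : m.hom a = 0 := by
    refine .trans (ConcreteCategory.congr_hom (Scheme.ΓSpecIso _).inv_hom_id (m.hom a)).symm ?_
    exact (congrArg (Scheme.ΓSpecIso _).hom.hom h7).trans
      (map_zero (Scheme.ΓSpecIso (CommRingCat.of _)).hom.hom)
  exact Ideal.mem_span_singleton.mp (Ideal.Quotient.eq_zero_iff_mem.mp h8)

lemma app_eq_zero_iff {U : L.X.Opens} (hU : IsAffineOpen U) {a : Γ(L.X, U)} :
    (L.i.app U).hom a = 0 ↔ (p : Γ(L.X, U)) * a = 0 := by
  have := L.flat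
  constructor
  · intro h
    obtain ⟨b, rfl⟩ := L.dvd_of_app_eq_zero hU h
    rw [← mul_assoc, ← map_natCast (structureHom L.str U), ← map_mul, W2.natCast_mul_natCast,
      map_zero, zero_mul]
  · intro h
    obtain ⟨b, rfl⟩ := W2.dvd_of_flat (flat_structureHom L.str hU) h
    rw [map_mul, map_natCast, natCast_eq_zero p f, zero_mul]

end FlatLift

lemma preimage_le_iSup_affineOpens {Y Z : Scheme.{u}} (g : Z ⟶ Y) (U : Y.Opens) :
    g ⁻¹ᵁ U ≤ ⨆ V : {V : Y.affineOpens // V.1 ≤ U}, g ⁻¹ᵁ V.1.1 := by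
  intro z hz
  obtain ⟨_, ⟨V, hV, rfl⟩, hzV, hVU⟩ :=
    Y.isBasis_affineOpens.exists_subset_of_mem_open (show g z ∈ (U : Set Y) from hz) U.isOpen
  exact Opens.mem_iSup.mpr ⟨⟨⟨V, hV⟩, hVU⟩, hzV⟩

/-- Sections over the preimage of an open subset are determined by their restrictions to the
preimages of its affine open subsets. -/
lemma eq_of_forall_isAffineOpen {Y Z : Scheme.{u}} (g : Z ⟶ Y) {U : Y.Opens} {x y : Γ(Z, g ⁻¹ᵁ U)}
    (h : ∀ (V : Y.Opens) (hV : V ≤ U), IsAffineOpen V →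
      (Z.presheaf.map (homOfLE (g.preimage_mono hV)).op).hom x =
        (Z.presheaf.map (homOfLE (g.preimage_mono hV)).op).hom y) : x = y := by
  refine Z.sheaf.eq_of_locally_eq' (fun V : {V : Y.affineOpens // V.1 ≤ U} => g ⁻¹ᵁ V.1.1)
    (g ⁻¹ᵁ U) (fun V => homOfLE (g.preimage_mono V.2))
    (preimage_le_iSup_affineOpens g U) x y fun V => h V.1.1 V.2 V.1.2

namespace SplitLift

variable {σ : (frobSequence p f).Splitting} (L : SplitLift σ)

lemma retraction_eq_zero_of_θ_ver {U : L.X.Opens} {y : Γ(S, L.i ⁻¹ᵁ U)}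
    (h : L.θ U (W2.ver p y) = 0) : retraction σ _ y = 0 := by
  refine eq_of_forall_isAffineOpen L.i fun V hV hV' => ?_
  rw [map_zero, retraction_naturality]
  obtain ⟨t, ht⟩ := L.i.app_surjective V hV'
    (retraction σ (L.i ⁻¹ᵁ V) ((S.presheaf.map (homOfLE (L.i.preimage_mono hV)).op).hom y))
  refine ht.symm.trans ((L.app_eq_zero_iff hV').mpr ?_)
  rw [← L.θ_ver V _ t ht, ← W2.map_ver, ← L.θ_restrict U V hV, h, map_zero]

/-- The kernel of `W₂(𝒪_S) → 𝒪_X` is the image under the Verschiebung of the kernel of the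
retraction. -/
lemma θ_eq_zero_iff {U : L.X.Opens} {w : W2 p Γ(S, L.i ⁻¹ᵁ U)} :
    L.θ U w = 0 ↔ w.coeff 0 = 0 ∧ retraction σ _ (w.coeff 1) = 0 := by
  constructor
  · intro h
    have h0 : w.coeff 0 = 0 := by
      rw [← W2.toBase_apply, ← L.θ_toBase, h, map_zero]
    rw [W2.eq_ver p h0] at h
    exact ⟨h0, L.retraction_eq_zero_of_θ_ver h⟩
  · rintro ⟨h0, h1⟩
    rw [W2.eq_ver p h0]
    exact L.θ_ver_of_retraction_eq_zero h1

/-- The homomorphism `W₂(𝒪_S) → 𝒪_X` is surjective on sections over every open subset: locally, a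
section that vanishes on `S` is the image of `V(t ^ p)` for a section `t` of `𝒪_S`, and the section
`t` is unique. -/
lemma θ_surjective (U : L.X.Opens) : Function.Surjective (L.θ U) := by
  intro s
  let d := s - L.θ U (W2.teich p ((L.i.app U).hom s))
  have hd : (L.i.app U).hom d = 0 := by
    rw [map_sub, L.θ_toBase, W2.toBase_apply, W2.coeff_zero_teich, sub_self]
  have hloc (V : {V : L.X.affineOpens // V.1 ≤ U}) : ∃ t : Γ(S, L.i ⁻¹ᵁ V.1.1),
      L.θ V.1.1 (W2.ver p (t ^ p)) = (L.X.presheaf.map (homOfLE V.2).op).hom d := by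
    have hV : (L.i.app V.1.1).hom ((L.X.presheaf.map (homOfLE V.2).op).hom d) = 0 := by
      refine (ConcreteCategory.congr_hom (L.i.naturality (homOfLE V.2).op) d).trans ?_
      exact (congrArg (S.presheaf.map _).hom hd).trans (map_zero (S.presheaf.map _).hom)
    obtain ⟨b, hb⟩ := L.dvd_of_app_eq_zero V.1.2 hV
    exact ⟨(L.i.app V.1.1).hom b, (L.θ_ver _ _ b (retraction_pow σ _ _).symm).trans hb.symm⟩
  choose t ht using hloc
  -- `θ (V(t ^ p))` determines `t = r (t ^ p)`, so the local sections `t` agree on overlaps.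
  have hres (V : {V : L.X.affineOpens // V.1 ≤ U}) (W : L.X.Opens) (hW : W ≤ V.1.1) :
      L.θ W (W2.ver p
        (((S.presheaf.map (homOfLE (L.i.preimage_mono hW)).op).hom (t V)) ^ p)) =
      (L.X.presheaf.map (homOfLE (hW.trans V.2)).op).hom d := by
    rw [← map_pow, ← W2.map_ver, ← L.θ_restrict, ht]
    exact (ConcreteCategory.congr_hom
      (L.X.presheaf.map_comp (homOfLE V.2).op (homOfLE hW).op) d).symm
  obtain ⟨(T : Γ(S, L.i ⁻¹ᵁ U)), hT, -⟩ := S.sheaf.existsUnique_gluing'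
    (fun V : {V : L.X.affineOpens // V.1 ≤ U} => L.i ⁻¹ᵁ V.1.1)
    (L.i ⁻¹ᵁ U) (fun V => homOfLE (L.i.preimage_mono V.2)) (preimage_le_iSup_affineOpens L.i U) t
    (by
      intro V V'
      have h1 := hres V (V.1.1 ⊓ V'.1.1) inf_le_left
      have h2 := hres V' (V.1.1 ⊓ V'.1.1) inf_le_right
      have h3 := L.retraction_eq_zero_of_θ_ver
        (((congrArg _ (W2.ver_sub p _ _)).trans (map_sub _ _ _)).trans
          (sub_eq_zero.mpr (h1.trans h2.symm)))
      rw [map_sub, retraction_pow, retraction_pow, sub_eq_zero] at h3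
      exact h3)
  refine ⟨W2.teich p ((L.i.app U).hom s) + W2.ver p (T ^ p), ?_⟩
  rw [map_add, ← eq_sub_iff_add_eq']
  refine eq_of_forall_isAffineOpen (𝟙 L.X) (U := U) fun V hV hV' => ?_
  refine (L.θ_restrict U V hV _).trans ?_
  rw [W2.map_ver, map_pow]
  refine .trans ?_ (ht ⟨⟨V, hV'⟩, hV⟩)
  exact congrArg (fun q => L.θ V (W2.ver p (q ^ p))) (hT ⟨⟨V, hV'⟩, hV⟩)

end SplitLift

end

/-! ### Functoriality and uniqueness -/

section

variable {p : ℕ} [hp : Fact p.Prime] {k : Type u} [Field k] [CharP k p]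
    {S S' S'' : Scheme.{u}} {f : S ⟶ Spec (.of k)} {f' : S' ⟶ Spec (.of k)}
    {f'' : S'' ⟶ Spec (.of k)} {σ : (frobSequence p f).Splitting}
    {σ' : (frobSequence p f').Splitting} {σ'' : (frobSequence p f'').Splitting}

lemma RespectsSplittings.appLE {g : S ⟶ S'} (hg : RespectsSplittings σ σ' g) {U : S'.Opens}
    {V : S.Opens} (e : V ≤ g ⁻¹ᵁ U) (y : Γ(S', U)) :
    (g.appLE U V e).hom (retraction σ' U y) = retraction σ V ((g.appLE U V e).hom y) := by
  refine .trans (congrArg (S.presheaf.map (homOfLE e).op).hom (hg U y)) ?_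
  exact retraction_naturality σ _ _

lemma appLE_structureHom {R : Type u} [CommRing R] {X Y : Scheme.{u}} (f : X ⟶ Spec (.of R))
    (g : Y ⟶ X) {U : X.Opens} {V : Y.Opens} (e : V ≤ g ⁻¹ᵁ U) (c : R) :
    (g.appLE U V e).hom (structureHom f U c) = structureHom (g ≫ f) V c := by
  refine .trans (congrArg (Y.presheaf.map (homOfLE e).op).hom (app_structureHom f g U c)) ?_
  exact map_structureHom _ _ _

lemma RespectsSplittings.id (σ : (frobSequence p f).Splitting) : RespectsSplittings σ σ (𝟙 S) :=
  fun _ _ => rfl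

lemma IsLiftOf.id (L : SplitLift σ) : IsLiftOf L L (𝟙 S) (𝟙 L.X) where
  comp_str := Category.id_comp _
  lift := by simp
  comm U w := by
    have h : (𝟙 S : S ⟶ S).appLE (L.i ⁻¹ᵁ U) (L.i ⁻¹ᵁ U) le_rfl = 𝟙 _ :=
      (𝟙 S : S ⟶ S).appLE_eq_app
    exact congrArg (fun q => L.θ U (W2.map p (CommRingCat.Hom.hom q) w)) h.symm

lemma IsLiftOf.comp {L : SplitLift σ} {L' : SplitLift σ'} {L'' : SplitLift σ''} {g : S ⟶ S'}
    {h : S' ⟶ S''} {g₂ : L.X ⟶ L'.X} {h₂ : L'.X ⟶ L''.X} (hg : IsLiftOf L L' g g₂)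
    (hh : IsLiftOf L' L'' h h₂) : IsLiftOf L L'' (g ≫ h) (g₂ ≫ h₂) where
  comp_str := by rw [Category.assoc, hh.comp_str, hg.comp_str]
  lift := by rw [← Category.assoc, hg.lift, Category.assoc, hh.lift, Category.assoc]
  comm U w := by
    refine (congrArg (g₂.app _).hom (hh.comm U w)).trans ((hg.comm _ _).trans ?_)
    rw [W2.map_comp, ← CommRingCat.hom_comp, Scheme.Hom.appLE_comp_appLE]
    rfl

variable [PerfectField k]

namespace SplitLift

variable (L : SplitLift σ) (L' : SplitLift σ') {g : S ⟶ S'} (hg : RespectsSplittings σ σ' g)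

lemma ker_θ_le (hg : RespectsSplittings σ σ' g) (U : L'.X.Opens) (V : L.X.Opens)
    (e : L.i ⁻¹ᵁ V ≤ g ⁻¹ᵁ L'.i ⁻¹ᵁ U) :
    RingHom.ker (L'.θ U) ≤ RingHom.ker ((L.θ V).comp (W2.map p (g.appLE _ _ e).hom)) := by
  intro w hw
  obtain ⟨h0, h1⟩ := L'.θ_eq_zero_iff.mp (RingHom.mem_ker.mp hw)
  refine L.θ_eq_zero_iff.mpr ⟨?_, ?_⟩
  · rw [W2.coeff_map, h0, map_zero]
  · rw [W2.coeff_map, ← hg.appLE, h1, map_zero]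

/-- The homomorphism `Γ(X', U) → Γ(X, V)` induced by `W₂(g^♯)` on the quotients of `W₂(𝒪_{S'})` and
`W₂(𝒪_S)`. -/
noncomputable def sectionHom (U : L'.X.Opens) (V : L.X.Opens) (e : L.i ⁻¹ᵁ V ≤ g ⁻¹ᵁ L'.i ⁻¹ᵁ U) :
    Γ(L'.X, U) →+* Γ(L.X, V) :=
  RingHom.liftOfRightInverse (L'.θ U) _ (Function.rightInverse_surjInv (L'.θ_surjective U))
    ⟨(L.θ V).comp (W2.map p (g.appLE _ _ e).hom), ker_θ_le L L' hg U V e⟩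

lemma sectionHom_θ (U : L'.X.Opens) (V : L.X.Opens) (e : L.i ⁻¹ᵁ V ≤ g ⁻¹ᵁ L'.i ⁻¹ᵁ U)
    (w : W2 p Γ(S', L'.i ⁻¹ᵁ U)) :
    sectionHom L L' hg U V e (L'.θ U w) = L.θ V (W2.map p (g.appLE _ _ e).hom w) :=
  RingHom.liftOfRightInverse_comp_apply (L'.θ U) _
    (Function.rightInverse_surjInv (L'.θ_surjective U))
    ⟨(L.θ V).comp (W2.map p (g.appLE _ _ e).hom), ker_θ_le L L' hg U V e⟩ w

lemma map_sectionHom {U U₁ : L'.X.Opens} (hU : U₁ ≤ U) {V V₁ : L.X.Opens} (hV : V₁ ≤ V)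
    (e : L.i ⁻¹ᵁ V ≤ g ⁻¹ᵁ L'.i ⁻¹ᵁ U) (e₁ : L.i ⁻¹ᵁ V₁ ≤ g ⁻¹ᵁ L'.i ⁻¹ᵁ U₁) (s : Γ(L'.X, U)) :
    (L.X.presheaf.map (homOfLE hV).op).hom (sectionHom L L' hg U V e s) =
      sectionHom L L' hg U₁ V₁ e₁ ((L'.X.presheaf.map (homOfLE hU).op).hom s) := by
  obtain ⟨w, rfl⟩ := L'.θ_surjective U s
  rw [sectionHom_θ, L.θ_restrict V V₁ hV, L'.θ_restrict U U₁ hU, sectionHom_θ, W2.map_comp,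
    W2.map_comp, ← CommRingCat.hom_comp, ← CommRingCat.hom_comp, g.appLE_map, g.map_appLE]

lemma app_sectionHom {U : L'.X.Opens} {V : L.X.Opens} (e : L.i ⁻¹ᵁ V ≤ g ⁻¹ᵁ L'.i ⁻¹ᵁ U)
    (s : Γ(L'.X, U)) : (L.i.app V).hom (sectionHom L L' hg U V e s) =
      (g.appLE _ _ e).hom ((L'.i.app U).hom s) := by
  obtain ⟨w, rfl⟩ := L'.θ_surjective U s
  rw [sectionHom_θ, L.θ_toBase, L'.θ_toBase]
  rfl

/-- The continuous map underlying the lift of `g`. -/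
noncomputable def liftBase (g : S ⟶ S') : L.X.carrier ⟶ L'.X.carrier :=
  inv L.i.base ≫ g.base ≫ L'.i.base

lemma i_base_comp_liftBase : L.i.base ≫ liftBase L L' g = g.base ≫ L'.i.base :=
  IsIso.hom_inv_id_assoc _ _

lemma preimage_liftBase (U : L'.X.Opens) :
    L.i ⁻¹ᵁ ((Opens.map (liftBase L L' g)).obj U) = g ⁻¹ᵁ L'.i ⁻¹ᵁ U :=
  congrArg (fun q => (Opens.map q).obj U) (i_base_comp_liftBase L L')

/-- The lift of `g`. -/
noncomputable def liftHom : L.X ⟶ L'.X where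
  base := liftBase L L' g
  c :=
    { app := fun U => CommRingCat.ofHom (sectionHom L L' hg U.unop
        ((Opens.map (liftBase L L' g)).obj U.unop) (preimage_liftBase L L' _).le)
      naturality := by
        intro U V j
        ext s
        exact (map_sectionHom L L' hg j.unop.le
          ((Opens.map (liftBase L L' g)).monotone j.unop.le) _ _ s).symm }
  prop x := by
    constructor
    intro a ha
    obtain ⟨U, hxU, s, rfl⟩ := L'.X.presheaf.exists_germ_eq a
    erw [PresheafedSpace.stalkMap_germ_apply] at ha
    obtain ⟨z, rfl⟩ := L.i.surjective x
    -- Units are detected on `S` and on `S'`, where the homomorphism is `g^♯`.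
    have h1 : z ∈ L.i ⁻¹ᵁ L.X.basicOpen (sectionHom L L' hg U _ (preimage_liftBase L L' U).le s) :=
      (L.X.mem_basicOpen _ _ hxU).mpr ha
    rw [Scheme.preimage_basicOpen] at h1
    have h2 : z ∈ S.basicOpen ((g.appLE _ _ (preimage_liftBase L L' U).le).hom
        ((L'.i.app U).hom s)) := by
      rwa [← app_sectionHom L L' hg]
    rw [Scheme.basicOpen_appLE, ← Scheme.preimage_basicOpen] at h2
    have h3 : liftBase L L' g (L.i z) ∈ L'.X.basicOpen s := by
      have := ConcreteCategory.congr_hom (i_base_comp_liftBase L L' (g := g)) z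
      exact Set.mem_of_eq_of_mem this h2.2
    exact (L'.X.mem_basicOpen _ _ hxU).mp h3

lemma liftHom_app_θ (U : L'.X.Opens) (w : W2 p Γ(S', L'.i ⁻¹ᵁ U)) :
    ((liftHom L L' hg).app U).hom (L'.θ U w) = L.θ (liftHom L L' hg ⁻¹ᵁ U)
      (W2.map p (g.appLE _ _ (preimage_liftBase L L' U).le).hom w) :=
  sectionHom_θ L L' hg U _ _ w

lemma i_comp_liftHom : L.i ≫ liftHom L L' hg = g ≫ L'.i := by
  refine Scheme.Hom.ext (i_base_comp_liftBase L L') fun U => ?_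
  ext s
  change (S.presheaf.map _).hom ((L.i.app ((Opens.map (liftBase L L' g)).obj U)).hom
    (sectionHom L L' hg U _ (preimage_liftBase L L' U).le s)) = (g.app _).hom ((L'.i.app U).hom s)
  rw [app_sectionHom]
  refine (ConcreteCategory.congr_hom (g.appLE_map _ _) _).trans ?_
  exact ConcreteCategory.congr_hom g.app_eq_appLE.symm _

lemma isLiftOf_liftHom (hgf : g ≫ f' = f) : IsLiftOf L L' g (liftHom L L' hg) where
  comp_str := by
    refine hom_ext_of_structureHom (RingHom.ext fun c => ?_)
    refine (app_structureHom L'.str (liftHom L L' hg) ⊤ c).symm.trans ?_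
    rw [← L'.θ_linear, ← L.θ_linear, liftHom_app_θ]
    refine congrArg (L.θ ⊤) ?_
    have h (V : S.Opens) (e : V ≤ g ⁻¹ᵁ L'.i ⁻¹ᵁ ⊤) : W2.map p (g.appLE _ V e).hom
        (W2.map p (structureHom f' (L'.i ⁻¹ᵁ ⊤)) c) = W2.map p (structureHom f V) c := by
      subst hgf
      ext <;> exact appLE_structureHom f' g e _
    exact h _ _
  lift := i_comp_liftHom L L' hg
  comm := liftHom_app_θ L L' hg

end SplitLift

namespace IsLiftOf

variable {L : SplitLift σ} {L' : SplitLift σ'} {g : S ⟶ S'}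

/-- A lift of `g` is unique: its continuous map is determined because `S` and `X` have the same
points, and its homomorphisms of rings because `θ'` is surjective. -/
lemma eq {g₁ g₂ : L.X ⟶ L'.X} (h₁ : IsLiftOf L L' g g₁)
    (h₂ : IsLiftOf L L' g g₂) : g₁ = g₂ := by
  have hb : g₁.base = g₂.base := by
    rw [← cancel_epi L.i.base]
    exact congrArg (fun q => q.base) (h₁.lift.trans h₂.lift.symm)
  refine Scheme.Hom.ext hb fun U => ?_
  ext s
  obtain ⟨w, rfl⟩ := L'.θ_surjective U s
  have h := h₂.comm U w
  refine .trans ?_ h.symm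
  refine (congrArg _ (h₁.comm U w)).trans ?_
  refine (L.θ_restrict _ _ (congrArg (fun q => (Opens.map q).obj U) hb).ge _).trans ?_
  rw [W2.map_comp, ← CommRingCat.hom_comp, g.appLE_map]

end IsLiftOf

lemma SplitLift.existsUnique_isLiftOf (L : SplitLift σ) (L' : SplitLift σ') {g : S ⟶ S'}
    (hgf : g ≫ f' = f) (hg : RespectsSplittings σ σ' g) : ∃! g₂ : L.X ⟶ L'.X, IsLiftOf L L' g g₂ :=
  ⟨L.liftHom L' hg, L.isLiftOf_liftHom L' hg hgf, fun _ h => h.eq (L.isLiftOf_liftHom L' hg hgf)⟩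

lemma SplitLift.existsUnique_iso (L L' : SplitLift σ) :
    ∃! e : L.X ≅ L'.X, IsLiftOf L L' (𝟙 S) e.hom := by
  have h (L L' : SplitLift σ) := L.isLiftOf_liftHom L' (.id σ) (Category.id_comp f)
  have hid (L L' : SplitLift σ) : L.liftHom L' (.id σ) ≫ L'.liftHom L (.id σ) = 𝟙 L.X := by
    refine IsLiftOf.eq (g := 𝟙 S) ?_ (.id L)
    simpa using (h L L').comp (h L' L)
  exact ⟨⟨L.liftHom L' (.id σ), L'.liftHom L (.id σ), hid L L', hid L' L⟩, h L L',
    fun e he => Iso.ext (he.eq (h L L'))⟩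

end

end FrobLift

theorem mainTheorem4 (p : ℕ) [Fact p.Prime] (k : Type u) [Field k] [CharP k p] [PerfectField k] :
    -- a reduced Frobenius-split scheme lifts to a flat scheme over `W₂(k)`
    (∀ (S : Scheme.{u}) (f : S ⟶ Spec (.of k)) [IsReduced S],
      Nonempty (FrobLift.frobSequence p f).Splitting → Nonempty (FrobLift.FlatLift p f)) ∧
    -- every splitting determines such a lift, as the pushforward of the extension `W₂(𝒪_S)`
    (∀ (S : Scheme.{u}) (f : S ⟶ Spec (.of k)) [IsReduced S]
      (σ : (FrobLift.frobSequence p f).Splitting), Nonempty (FrobLift.SplitLift σ)) ∧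
    -- this lift is unique up to unique isomorphism
    (∀ (S : Scheme.{u}) (f : S ⟶ Spec (.of k)) [IsReduced S]
      (σ : (FrobLift.frobSequence p f).Splitting) (L L' : FrobLift.SplitLift σ),
      ∃! e : L.X ≅ L'.X, FrobLift.IsLiftOf L L' (𝟙 S) e.hom) ∧
    -- this lift is functorial in the scheme with its splitting
    (∀ (S S' : Scheme.{u}) (f : S ⟶ Spec (.of k)) (f' : S' ⟶ Spec (.of k))
      [IsReduced S] [IsReduced S']
      (σ : (FrobLift.frobSequence p f).Splitting) (σ' : (FrobLift.frobSequence p f').Splitting)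
      (L : FrobLift.SplitLift σ) (L' : FrobLift.SplitLift σ') (g : S ⟶ S'), g ≫ f' = f →
      FrobLift.RespectsSplittings σ σ' g →
      ∃! g₂ : L.X ⟶ L'.X, FrobLift.IsLiftOf L L' g g₂) := by
  refine ⟨fun S f _ ⟨σ⟩ => ⟨(FrobLift.extLift σ).toFlatLift⟩,
    fun S f _ σ => ⟨FrobLift.extLift σ⟩, fun S f _ σ L L' => L.existsUnique_iso L',
    fun S S' f f' _ _ σ σ' L L' g hgf hg => L.existsUnique_isLiftOf L' hgf hg⟩
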